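/- Let $\mathrm F$ be a field of characteristic $0$ (for instance a local field of characteristic $0$), and let $\mathrm D$ be a finite-dimensional division algebra over $\mathrm F$ with an $\mathrm F$-linear involution (involutive anti-automorphism) $a\mapsto a^{\natural}$. Let $\epsilon,\epsilon'\in\{\pm1\}$ with $\epsilon\epsilon'=-1$. Let $V$ be an $\epsilon$-Hermitian $\mathrm D$-space, i.e. a finite-dimensional right $\mathrm D$-vector space with a non-degenerate $\mathrm F$-bilinear form $\langle\cdot,\cdot\rangle_V:V\times V\to \mathrm D$ such that $\langle ua,v\rangle_V=\langle u,v\rangle_V\,a$ and $\langle u,v\rangle_V=\epsilon\langle v,u\rangle_V^{\natural}$ for $u,v\in V$, $a\in \mathrm D$; let $V'$ be an $\epsilon'$-Hermitian $\mathrm D$-space. Let $G,G'$ be the isometry groups of $V,V'$, and let $$\mathfrak g=\{Z\in\operatorname{End}_{\mathrm D}(V):\langle Zu,v\rangle_V+\langle u,Zv\rangle_V=0 \text{ for all } u,v\in V\},$$ and similarly $\mathfrak g'$, be their Lie algebras, with the adjoint actions $\operatorname{Ad}(g)Z=gZg^{-1}$. For $T\in\operatorname{Hom}_{\mathrm D}(V,V')$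 let $T^*\in\operatorname{Hom}_{\mathrm D}(V',V)$ be defined by $\langle Tv,v'\rangle_{V'}=\langle v,T^*v'\rangle_V$, and define the moment maps $\varphi(T)=T^*T\in\mathfrak g$ and $\varphi'(T)=TT^*\in\mathfrak g'$. An $\mathfrak{sl}_2$-triple $\gamma=\{X,H,Y\}\subset\mathfrak g$ consists of $X,H,Y\in\mathfrak g$ with $[H,X]=2X$, $[H,Y]=-2Y$, $[X,Y]=H$ (the zero triple is allowed). Put $V_k=\{v\in V: Hv=kv\}$ for $k\in\mathbb Z$ and $M_X=\{m\in G:\operatorname{Ad}(m)H=H,\ \operatorname{Ad}(m)X=X\}$; for an $\mathfrak{sl}_2$-triple $\gamma'=\{X',H',Y'\}\subset\mathfrak g'$ define $V'_k$ and $M'_{X'}$ in the same way. Let $\mathcal O_{\gamma,\gamma'}$ be the set of all $T\in\operatorname{Hom}_{\mathrm D}(V,V')$ such that (1) $\varphi(T)=X$ and $\varphi'(T)=X'$; (2) $T(V_k)\subset V'_{k+1}$ for all $k\in\mathbb Z$; (3) $\operatorname{Ker}(T)$ is a non-degenerate subspace of $V$. Let $\gamma'=\{X',H',Y'\}\subset\mathfrak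 g'$ be an $\mathfrak{sl}_2$-triple such that $X'$ is in the image of $\varphi'$. Then there is a unique $G$-conjugacy class of $\mathfrak{sl}_2$-triples $\gamma=\{X,H,Y\}\subset\mathfrak g$ such that $\mathcal O_{\gamma,\gamma'}$ is non-empty; that is, the set of all $\gamma$ with $\mathcal O_{\gamma,\gamma'}\neq\emptyset$ is exactly one $G$-conjugacy class. Furthermore, for every such $\gamma$ the set $\mathcal O_{\gamma,\gamma'}$ is a single orbit of $M_X\times M'_{X'}$ acting by $(m,m')\cdot T=m'Tm^{-1}$. -/

import Mathlib

open scoped MulOpposite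

attribute [local instance 100] LieRing.ofAssociativeRing

/-- An `ε`-Hermitian form (`ε = ±1`) on a right vector space `V` over a division ring `D` with
involution `star`; right `D`-modules are modules over `Dᵐᵒᵖ`, and `v a` is `MulOpposite.op a • v`.
Non-degeneracy is part of the definition. -/
structure EpsHermitianForm (D : Type*) [DivisionRing D] [StarRing D]
    (V : Type*) [AddCommGroup V] [Module Dᵐᵒᵖ V] (ε : ℤˣ) where
  form : V →+ V →+ D
  smul_left : ∀ (a : D) (u v : V), form (MulOpposite.op a • u) v = form u v * a
  hermitian : ∀ u v : V, form u v = ((ε : ℤ) : D) * star (form v u)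
  nondegenerate : ∀ u : V, (∀ v : V, form u v = 0) → u = 0

/-- An `sl₂`-triple `{X, H, Y}` in a Lie ring (the zero triple is allowed). -/
structure SlTwoTriple (L : Type*) [LieRing L] where
  X : L
  H : L
  Y : L
  lie_H_X : ⁅H, X⁆ = (2 : ℤ) • X
  lie_H_Y : ⁅H, Y⁆ = (-2 : ℤ) • Y
  lie_X_Y : ⁅X, Y⁆ = H

namespace EpsHermitianForm

section Basic

variable {D : Type*} [DivisionRing D] [StarRing D]
  {V : Type*} [AddCommGroup V] [Module Dᵐᵒᵖ V] {ε : ℤˣ}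

theorem smul_right (B : EpsHermitianForm D V ε) (a : D) (u v : V) :
    B.form u (MulOpposite.op a • v) = star a * B.form u v := by
  rw [B.hermitian u, B.smul_left, star_mul, B.hermitian u v, ← mul_assoc, ← mul_assoc,
    (Int.cast_commute (ε : ℤ) (star a)).eq]

theorem nondegenerate_right (B : EpsHermitianForm D V ε) (v : V)
    (h : ∀ u : V, B.form u v = 0) : v = 0 :=
  B.nondegenerate v fun w => by rw [B.hermitian, h w, star_zero, mul_zero]

/-- A subspace `W` is non-degenerate if the restriction of the form to `W` is non-degenerate. -/
def IsNondegenerateSubspace (B : EpsHermitianForm D V ε) (W : Submodule Dᵐᵒᵖ V) : Prop :=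
  ∀ u ∈ W, (∀ v ∈ W, B.form u v = 0) → u = 0

/-- The isometry group `G(V)`. -/
def isometryGroup (B : EpsHermitianForm D V ε) : Subgroup (V ≃ₗ[Dᵐᵒᵖ] V) where
  carrier := {g | ∀ u v : V, B.form (g u) (g v) = B.form u v}
  one_mem' _ _ := rfl
  mul_mem' {a b} ha hb u v := by
    rw [LinearEquiv.mul_apply, LinearEquiv.mul_apply, ha, hb]
  inv_mem' {a} ha u v := by
    have h := ha (a⁻¹ u) (a⁻¹ v)
    have e : ∀ w : V, a (a⁻¹ w) = w := fun w => a.apply_symm_apply w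
    rw [e, e] at h
    exact h.symm

/-- The form as a semilinear map from `V` to the space of `D`-linear functionals on `V`. -/
def toFunctional (B : EpsHermitianForm D V ε) (v : V) : V →ₗ[Dᵐᵒᵖ] D where
  toFun u := B.form u v
  map_add' u w := by simp
  map_smul' a u := by
    obtain ⟨a, rfl⟩ := MulOpposite.op_surjective a
    simp [B.smul_left]

/-- Every `D`-linear functional on a finite-dimensional space is represented by the form. -/
theorem exists_representative [Module.Finite Dᵐᵒᵖ V] (B : EpsHermitianForm D V ε)
    (f : V →ₗ[Dᵐᵒᵖ] D) : ∃ w : V, ∀ u : V, f u = B.form u w := by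
  classical
  let b := Module.finBasis Dᵐᵒᵖ V
  let r : Fin (Module.finrank Dᵐᵒᵖ V) → (Fin (Module.finrank Dᵐᵒᵖ V) → D) :=
    fun j i => B.form (b i) (b j)
  have hrep : ∀ (c : Fin (Module.finrank Dᵐᵒᵖ V) → D) (u : V),
      B.form u (∑ j, MulOpposite.op (star (c j)) • b j) = ∑ j, c j * B.form u (b j) := by
    intro c u
    rw [map_sum]
    exact Finset.sum_congr rfl fun j _ => by rw [B.smul_right, star_star]
  have hli : LinearIndependent D r := by
    rw [Fintype.linearIndependent_iff]
    intro c hc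
    have h0 : (∑ j, MulOpposite.op (star (c j)) • b j) = 0 := by
      apply B.nondegenerate_right
      have hz : B.toFunctional (∑ j, MulOpposite.op (star (c j)) • b j) = 0 := by
        refine b.ext fun i => ?_
        have := congrFun hc i
        simp only [Finset.sum_apply, Pi.smul_apply, smul_eq_mul, Pi.zero_apply, r] at this
        exact (hrep c (b i)).trans this
      intro u
      exact LinearMap.congr_fun hz u
    intro i
    have := Fintype.linearIndependent_iff.mp b.linearIndependent _ h0 i
    simpa using this
  have hspan : Submodule.span D (Set.range r) = ⊤ :=
    hli.span_eq_top_of_card_eq_finrank' (by simp)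
  have hmem : (fun i => f (b i)) ∈ Submodule.span D (Set.range r) := by
    rw [hspan]; trivial
  obtain ⟨c, hc⟩ := (Submodule.mem_span_range_iff_exists_fun D).mp hmem
  refine ⟨∑ j, MulOpposite.op (star (c j)) • b j, fun u => ?_⟩
  have : f = B.toFunctional (∑ j, MulOpposite.op (star (c j)) • b j) := by
    refine b.ext fun i => ?_
    have h := congrFun hc i
    simp only [Finset.sum_apply, Pi.smul_apply, smul_eq_mul, r] at h
    exact h.symm.trans (hrep c (b i)).symm
  exact LinearMap.congr_fun this u

end Basic

section Pair

variable {D : Type*} [DivisionRing D] [StarRing D]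
  {V : Type*} [AddCommGroup V] [Module Dᵐᵒᵖ V] [Module.Finite Dᵐᵒᵖ V]
  {V' : Type*} [AddCommGroup V'] [Module Dᵐᵒᵖ V'] {ε ε' : ℤˣ}

theorem exists_adjoint (B : EpsHermitianForm D V ε) (B' : EpsHermitianForm D V' ε')
    (T : V →ₗ[Dᵐᵒᵖ] V') :
    ∃ S : V' →ₗ[Dᵐᵒᵖ] V, ∀ (v : V) (v' : V'), B'.form (T v) v' = B.form v (S v') := by
  choose s hs using fun v' : V' => B.exists_representative ((B'.toFunctional v').comp T)
  have hs' : ∀ (v : V) (v' : V'), B'.form (T v) v' = B.form v (s v') := fun v v' => hs v' v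
  refine ⟨⟨⟨s, fun x y => ?_⟩, fun a x => ?_⟩, hs'⟩
  · refine sub_eq_zero.mp (B.nondegenerate_right _ fun u => ?_)
    rw [map_sub, map_add, ← hs', ← hs', ← hs', map_add, sub_self]
  · obtain ⟨a, rfl⟩ := MulOpposite.op_surjective a
    refine sub_eq_zero.mp (B.nondegenerate_right _ fun u => ?_)
    rw [map_sub, RingHom.id_apply, B.smul_right, ← hs', ← hs', B'.smul_right, sub_self]

/-- The adjoint `T* : V' → V` of `T : V → V'`, the unique `D`-linear map with
`⟨T v, v'⟩ = ⟨v, T* v'⟩`. -/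
noncomputable def adjoint (B : EpsHermitianForm D V ε) (B' : EpsHermitianForm D V' ε')
    (T : V →ₗ[Dᵐᵒᵖ] V') : V' →ₗ[Dᵐᵒᵖ] V :=
  (B.exists_adjoint B' T).choose

theorem adjoint_spec (B : EpsHermitianForm D V ε) (B' : EpsHermitianForm D V' ε')
    (T : V →ₗ[Dᵐᵒᵖ] V') (v : V) (v' : V') :
    B'.form (T v) v' = B.form v (B.adjoint B' T v') :=
  (B.exists_adjoint B' T).choose_spec v v'

theorem adjoint_spec' (B : EpsHermitianForm D V ε) (B' : EpsHermitianForm D V' ε')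
    (h : ε * ε' = -1) (T : V →ₗ[Dᵐᵒᵖ] V') (v' : V') (v : V) :
    B.form (B.adjoint B' T v') v = -B'.form v' (T v) := by
  rw [B.hermitian, ← B.adjoint_spec B', B'.hermitian v']
  have hε : ε = -ε' := by
    rw [← mul_one ε, ← Int.units_mul_self ε', ← mul_assoc, h, neg_one_mul]
  simp [hε]

end Pair

section LieAlgebra

variable (F : Type*) [Field F] {D : Type*} [DivisionRing D] [StarRing D] [Algebra F D]
  {V : Type*} [AddCommGroup V] [Module F V] [Module Dᵐᵒᵖ V] [IsScalarTower F Dᵐᵒᵖ V]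
  {ε : ℤˣ}

/-- The Lie algebra `𝔤` of `G(V)`: the `D`-linear endomorphisms `Z` of `V` with
`⟨Z u, v⟩ + ⟨u, Z v⟩ = 0`, a Lie algebra over `F` when the involution of `D` fixes `F`. -/
def lieAlgebra (B : EpsHermitianForm D V ε)
    (hF : ∀ c : F, star (algebraMap F D c) = algebraMap F D c) :
    LieSubalgebra F (Module.End Dᵐᵒᵖ V) where
  carrier := {Z | ∀ u v : V, B.form (Z u) v + B.form u (Z v) = 0}
  zero_mem' u v := by simp
  add_mem' {Z₁ Z₂} h₁ h₂ u v := by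
    have := congrArg₂ (· + ·) (h₁ u v) (h₂ u v)
    simp only [add_zero] at this
    rw [← this, LinearMap.add_apply, LinearMap.add_apply, map_add, map_add,
      AddMonoidHom.add_apply]
    abel
  smul_mem' c Z hZ u v := by
    have e : ∀ w : V, c • w = MulOpposite.op (algebraMap F D c) • w := fun w => by
      rw [← MulOpposite.algebraMap_apply, algebraMap_smul]
    rw [LinearMap.smul_apply, LinearMap.smul_apply, e, e, B.smul_left, B.smul_right, hF,
      ← Algebra.commutes c (B.form (Z u) v), ← mul_add, hZ, mul_zero]
  lie_mem' {Z₁ Z₂} h₁ h₂ u v := by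
    have h₁' : ∀ u v : V, B.form (Z₁ u) v = -B.form u (Z₁ v) := fun u v =>
      eq_neg_of_add_eq_zero_left (h₁ u v)
    have h₂' : ∀ u v : V, B.form (Z₂ u) v = -B.form u (Z₂ v) := fun u v =>
      eq_neg_of_add_eq_zero_left (h₂ u v)
    simp only [Ring.lie_def, LinearMap.sub_apply, Module.End.mul_apply, map_sub,
      AddMonoidHom.sub_apply, h₁', h₂']
    abel

variable {F} {hF : ∀ c : F, star (algebraMap F D c) = algebraMap F D c}

/-- The adjoint action of `G(V)` on `𝔤`: `Ad(g) Z = g Z g⁻¹`. -/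
def Ad (B : EpsHermitianForm D V ε) (g : B.isometryGroup) (Z : B.lieAlgebra F hF) :
    B.lieAlgebra F hF :=
  ⟨(g : V ≃ₗ[Dᵐᵒᵖ] V).toLinearMap ∘ₗ (Z : Module.End Dᵐᵒᵖ V) ∘ₗ
      (g : V ≃ₗ[Dᵐᵒᵖ] V).symm.toLinearMap, fun u v => by
    have h := Z.2 ((g : V ≃ₗ[Dᵐᵒᵖ] V).symm u) ((g : V ≃ₗ[Dᵐᵒᵖ] V).symm v)
    rw [← g.2, ← g.2 _ ((Z : Module.End Dᵐᵒᵖ V) _), LinearEquiv.apply_symm_apply,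
      LinearEquiv.apply_symm_apply] at h
    exact h⟩

theorem Ad_one (B : EpsHermitianForm D V ε) (Z : B.lieAlgebra F hF) : B.Ad 1 Z = Z := rfl

theorem Ad_mul (B : EpsHermitianForm D V ε) (g₁ g₂ : B.isometryGroup)
    (Z : B.lieAlgebra F hF) : B.Ad (g₁ * g₂) Z = B.Ad g₁ (B.Ad g₂ Z) := rfl

/-- Two triples `γ₁`, `γ₂` in `𝔤` are conjugate under the adjoint action of `G(V)`. -/
def IsConjTriple (B : EpsHermitianForm D V ε) (γ₁ γ₂ : SlTwoTriple (B.lieAlgebra F hF)) :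
    Prop :=
  ∃ g : B.isometryGroup, B.Ad g γ₁.X = γ₂.X ∧ B.Ad g γ₁.H = γ₂.H ∧ B.Ad g γ₁.Y = γ₂.Y

/-- `M_X = {m ∈ G(V) : Ad(m) H = H, Ad(m) X = X}`. -/
def tripleStabilizer (B : EpsHermitianForm D V ε) (γ : SlTwoTriple (B.lieAlgebra F hF)) :
    Subgroup B.isometryGroup where
  carrier := {m | B.Ad m γ.H = γ.H ∧ B.Ad m γ.X = γ.X}
  one_mem' := ⟨rfl, rfl⟩
  mul_mem' {a b} ha hb :=
    ⟨by rw [Ad_mul, hb.1, ha.1], by rw [Ad_mul, hb.2, ha.2]⟩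
  inv_mem' {a} ha :=
    ⟨by conv_lhs => rw [← ha.1, ← Ad_mul, inv_mul_cancel, Ad_one],
     by conv_lhs => rw [← ha.2, ← Ad_mul, inv_mul_cancel, Ad_one]⟩

/-- The weight space `V_k = {v ∈ V : H v = k v}`. -/
def weightSpace (B : EpsHermitianForm D V ε) (γ : SlTwoTriple (B.lieAlgebra F hF)) (k : ℤ) :
    Set V :=
  {v | (γ.H : Module.End Dᵐᵒᵖ V) v = k • v}

end LieAlgebra

section Descent

variable {F : Type*} [Field F] {D : Type*} [DivisionRing D] [StarRing D] [Algebra F D]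
  {V : Type*} [AddCommGroup V] [Module F V] [Module Dᵐᵒᵖ V] [IsScalarTower F Dᵐᵒᵖ V]
  [Module.Finite Dᵐᵒᵖ V]
  {V' : Type*} [AddCommGroup V'] [Module F V'] [Module Dᵐᵒᵖ V'] [IsScalarTower F Dᵐᵒᵖ V']
  {ε ε' : ℤˣ}

/-- The moment map `φ : Hom(V, V') → 𝔤`, `φ(T) = T* T`. -/
noncomputable def momentMap (hF : ∀ c : F, star (algebraMap F D c) = algebraMap F D c)
    (B : EpsHermitianForm D V ε) (B' : EpsHermitianForm D V' ε') (h : ε * ε' = -1)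
    (T : V →ₗ[Dᵐᵒᵖ] V') : B.lieAlgebra F hF :=
  ⟨B.adjoint B' T ∘ₗ T, fun u v => by
    rw [LinearMap.comp_apply, LinearMap.comp_apply, B.adjoint_spec' B' h, ← B.adjoint_spec B',
      neg_add_cancel]⟩

/-- The moment map `φ' : Hom(V, V') → 𝔤'`, `φ'(T) = T T*`. -/
noncomputable def momentMap' (hF : ∀ c : F, star (algebraMap F D c) = algebraMap F D c)
    (B : EpsHermitianForm D V ε) (B' : EpsHermitianForm D V' ε') (h : ε * ε' = -1)
    (T : V →ₗ[Dᵐᵒᵖ] V') : B'.lieAlgebra F hF :=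
  ⟨T ∘ₗ B.adjoint B' T, fun u v => by
    rw [LinearMap.comp_apply, LinearMap.comp_apply, B.adjoint_spec B',
      ← neg_eq_iff_eq_neg.mpr (B.adjoint_spec' B' h T u _), add_neg_cancel]⟩

/-- The set `𝒪_{γ,γ'}` of all `T ∈ Hom(V, V')` which lift `γ` to `γ'`. -/
def liftSet {hF : ∀ c : F, star (algebraMap F D c) = algebraMap F D c}
    (B : EpsHermitianForm D V ε) (B' : EpsHermitianForm D V' ε') (h : ε * ε' = -1)
    (γ : SlTwoTriple (B.lieAlgebra F hF)) (γ' : SlTwoTriple (B'.lieAlgebra F hF)) :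
    Set (V →ₗ[Dᵐᵒᵖ] V') :=
  {T | momentMap hF B B' h T = γ.X ∧ momentMap' hF B B' h T = γ'.X ∧
    (∀ k : ℤ, ∀ v ∈ B.weightSpace γ k, T v ∈ B'.weightSpace γ' (k + 1)) ∧
    B.IsNondegenerateSubspace (LinearMap.ker T)}

/-- The orbit of `T ∈ Hom(V, V')` under `M_X × M'_{X'}`, which acts by
`(m, m') · T = m' T m⁻¹`. -/
def stabilizerOrbit {hF : ∀ c : F, star (algebraMap F D c) = algebraMap F D c}
    (B : EpsHermitianForm D V ε) (B' : EpsHermitianForm D V' ε')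
    (γ : SlTwoTriple (B.lieAlgebra F hF)) (γ' : SlTwoTriple (B'.lieAlgebra F hF))
    (T : V →ₗ[Dᵐᵒᵖ] V') : Set (V →ₗ[Dᵐᵒᵖ] V') :=
  {T₁ | ∃ m ∈ B.tripleStabilizer γ, ∃ m' ∈ B'.tripleStabilizer γ',
    T₁ = (m' : V' ≃ₗ[Dᵐᵒᵖ] V').toLinearMap ∘ₗ T ∘ₗ (m : V ≃ₗ[Dᵐᵒᵖ] V).symm.toLinearMap}

end Descent

end EpsHermitianForm

/-!
Let `T` lift `γ` to `γ'` and write `R = T*`. Since `R T = X`, `T R = X'` and the kernel of `T` is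
non-degenerate, `V` is the orthogonal sum of the image of `R` and the kernel of `T`, the kernel of
`R` is the kernel of `X'`, and `⟨R u, R v⟩ = ⟨X' u, v⟩'`. Thus the image of `R` is a copy of
`V' / ker X'` with a form which depends on `γ'` only.

*Uniqueness.* For two lifts `T₁`, `T₂`, possibly of different triples `γ₁`, `γ₂`, the map
`T₁* v ↦ T₂* v` is therefore an isometry between non-degenerate subspaces of `V`, and Witt's theorem
(`EpsHermitianForm.exists_isometry_extension`) extends it to some `g` in `G`, for which
`T₂ g = T₁`. It carries `γ₁` to `γ₂`. For `X = R T` this is clear. The space `V` is the sum of the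
weight spaces of `H` (`IsSlTwoRelation.mem_iSup_weightSpace`), so the weight condition says
`H R = R (H' + 1)`, while `H = 0` on the kernel of `T`: there `H k = X Y k` lies both in the kernel
of `T` and in the image of `R`. Finally `Y` is determined by `X` and `H`
(`IsSlTwoRelation.unique_Y`). This gives both the single conjugacy class and the single orbit; for
the latter, elements of `M_X` alone suffice to move one lift to another
(`EpsHermitianForm.exists_isometry_of_mem_liftSet`).

*Existence.* If `X' = S S*`, let `R` be `S*` composed with a projection along the kernel of `X'`.
Its image is non-degenerate, and `R` is the adjoint of some `T` with `T R = X'`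
(`EpsHermitianForm.exists_map_with_nondegenerate_ker`). Put `X = R T`, let `H` be induced by
`H' + 1` through `R`, and let all operators vanish on the kernel of `T`. It remains to complete `X'`
and `H' + 1` to an `sl₂`-triple on `V' / ker X'`. The irreducible summands of dimension `n` in `V'`
lose their highest weight vector, so that the third operator `Y₁` satisfies
`X' Y₁ = ((n - 1) ^ 2 - H' ^ 2) / 4`. The scalar `n` is the value of a polynomial `N` in the Casimir
operator, whose value is `n ^ 2`; the argument only needs that `N` commutes with the triple, is
self-adjoint and equals `H' + 1` on the kernel of `X'`
(`IsSlTwoRelation.exists_aeval_casimir_eq`, `EpsHermitianForm.exists_shifted_product`).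
-/

/-! ### Generalized inverses -/

/-- Every linear map over a division ring has a generalized inverse. -/
theorem LinearMap.exists_generalizedInverse {K M N : Type*} [DivisionRing K] [AddCommGroup M]
    [Module K M] [AddCommGroup N] [Module K N] (f : M →ₗ[K] N) :
    ∃ j : N →ₗ[K] M, ∀ x, f (j (f x)) = f x := by
  obtain ⟨i, hi⟩ := f.rangeRestrict.exists_rightInverse_of_surjective f.range_rangeRestrict
  obtain ⟨j, hj⟩ := i.exists_extend
  refine ⟨j, fun x => ?_⟩
  have h1 : j (f x) = i (f.rangeRestrict x) := LinearMap.congr_fun hj (f.rangeRestrict x)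
  have h2 := congrArg Subtype.val (LinearMap.congr_fun hi (f.rangeRestrict x))
  rw [h1]
  exact h2

namespace EpsHermitianForm

/-! ### Orthogonality -/

section Orthogonality

variable {D : Type*} [DivisionRing D] [StarRing D]
  {V : Type*} [AddCommGroup V] [Module Dᵐᵒᵖ V] {ε : ℤˣ}

theorem form_eq_zero_symm (B : EpsHermitianForm D V ε) {u v : V} (h : B.form u v = 0) :
    B.form v u = 0 := by
  rw [B.hermitian, h, star_zero, mul_zero]

theorem eq_of_forall_form_eq (B : EpsHermitianForm D V ε) {u v : V}
    (h : ∀ w, B.form w u = B.form w v) : u = v :=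
  sub_eq_zero.mp <| B.nondegenerate_right _ fun w => by rw [map_sub, h, sub_self]

theorem form_sub_left (B : EpsHermitianForm D V ε) (u v w : V) :
    B.form (u - v) w = B.form u w - B.form v w := by
  rw [map_sub, AddMonoidHom.sub_apply]

theorem form_add_left (B : EpsHermitianForm D V ε) (u v w : V) :
    B.form (u + v) w = B.form u w + B.form v w := by
  rw [map_add, AddMonoidHom.add_apply]

theorem form_neg_left (B : EpsHermitianForm D V ε) (u w : V) :
    B.form (-u) w = - B.form u w := by
  rw [map_neg, AddMonoidHom.neg_apply]

/-- A vector outside a subspace is separated from it by a vector of its orthogonal complement. -/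
theorem exists_orthogonal_of_notMem [Module.Finite Dᵐᵒᵖ V] (B : EpsHermitianForm D V ε)
    {W : Submodule Dᵐᵒᵖ V} {u : V} (hu : u ∉ W) :
    ∃ y, (∀ x ∈ W, B.form x y = 0) ∧ B.form u y ≠ 0 := by
  obtain ⟨f, hfu, hfW⟩ := Submodule.exists_le_ker_of_notMem hu
  let φ : V →ₗ[Dᵐᵒᵖ] D :=
    { toFun := fun v => MulOpposite.unop (f v)
      map_add' := by simp
      map_smul' := fun a v => by
        obtain ⟨a, rfl⟩ := MulOpposite.op_surjective a
        simp }
  obtain ⟨y, hy⟩ := B.exists_representative φ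
  refine ⟨y, fun x hx => ?_, ?_⟩
  · rw [← hy]
    exact congrArg MulOpposite.unop (LinearMap.mem_ker.mp (hfW hx))
  · rw [← hy]
    exact fun h0 => hfu (MulOpposite.unop_injective h0)

/-- A non-degenerate subspace splits off as an orthogonal summand. -/
theorem exists_orthogonal_decomposition [Module.Finite Dᵐᵒᵖ V] (B : EpsHermitianForm D V ε)
    {W : Submodule Dᵐᵒᵖ V} (hW : B.IsNondegenerateSubspace W) (v : V) :
    ∃ w ∈ W, ∀ x ∈ W, B.form x (v - w) = 0 := by
  let BW : EpsHermitianForm D W ε :=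
    { form := (B.form.compl₂ W.subtype.toAddMonoidHom).comp W.subtype.toAddMonoidHom
      smul_left := fun a u v => B.smul_left a u v
      hermitian := fun u v => B.hermitian u v
      nondegenerate := fun u h => Subtype.ext (hW u u.2 fun v hv => h ⟨v, hv⟩) }
  obtain ⟨w, hw⟩ := BW.exists_representative ((B.toFunctional v).comp W.subtype)
  refine ⟨w, w.2, fun x hx => ?_⟩
  rw [map_sub, sub_eq_zero]
  exact hw ⟨x, hx⟩

/-- A form-preserving endomorphism of a finite-dimensional space belongs to the isometry group. -/
theorem exists_isometry_of_linearMap [Module.Finite Dᵐᵒᵖ V] (B : EpsHermitianForm D V ε)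
    (f : V →ₗ[Dᵐᵒᵖ] V) (hf : ∀ x y, B.form (f x) (f y) = B.form x y) :
    ∃ g : B.isometryGroup, ∀ x, (g : V ≃ₗ[Dᵐᵒᵖ] V) x = f x := by
  have hinj : Function.Injective f := by
    rw [injective_iff_map_eq_zero]
    intro x hx
    exact B.nondegenerate x fun y => by rw [← hf, hx, map_zero, AddMonoidHom.zero_apply]
  exact ⟨⟨LinearEquiv.ofInjectiveEndo f hinj, fun u v => hf u v⟩, fun x => rfl⟩

/-- If a non-zero non-degenerate subspace carries no anisotropic vector, then the involution is
trivial, `ε = -1`, and the form is alternating on the whole space. -/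
theorem alternating_of_alternating_on (h2 : (2 : D) ≠ 0) (B : EpsHermitianForm D V ε)
    {W : Submodule Dᵐᵒᵖ V} (hW : B.IsNondegenerateSubspace W) (hne : W ≠ ⊥)
    (halt : ∀ x ∈ W, B.form x x = 0) (x : V) : B.form x x = 0 := by
  have hskew : ∀ u ∈ W, ∀ v ∈ W, B.form v u = - B.form u v := fun u hu v hv => by
    have h := halt _ (W.add_mem hu hv)
    rw [form_add_left, map_add, map_add, halt u hu, halt v hv, zero_add, add_zero] at h
    exact eq_neg_of_add_eq_zero_right h
  obtain ⟨u, hu, hu0⟩ := Submodule.exists_mem_ne_zero_of_ne_bot hne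
  obtain ⟨v, hv, huv⟩ : ∃ v ∈ W, B.form u v ≠ 0 := by
    by_contra! hc
    exact hu0 (hW u hu hc)
  set c := B.form u v with hc
  -- `u ↦ u b` with `b` arbitrary shows `ε b* = -b`
  have key : ∀ b : D, ((ε : ℤ) : D) * star b = -b := fun b => by
    have h := hskew _ (W.smul_mem (MulOpposite.op (c⁻¹ * b)) hu) v hv
    have h' := B.hermitian v (MulOpposite.op (c⁻¹ * b) • u)
    rw [B.smul_left, ← hc, mul_inv_cancel_left₀ huv] at h h'
    rw [← h', h]
  have h := (B.hermitian x x).trans (key _)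
  have h3 : 2 * B.form x x = 0 := by
    rw [two_mul]
    nth_rewrite 1 [h]
    rw [neg_add_cancel]
  exact (mul_eq_zero.mp h3).resolve_left h2

end Orthogonality

/-! ### Witt's extension theorem -/

section Witt

variable {D : Type*} [DivisionRing D] [StarRing D]
  {V : Type*} [AddCommGroup V] [Module Dᵐᵒᵖ V] [Module.Finite Dᵐᵒᵖ V] {ε : ℤˣ}

/-- The quasi-reflection `x ↦ x - w ⟨u, w⟩⁻¹ ⟨x, w⟩` with `w = u - v` moves `u` to `v`. -/
theorem exists_quasiReflection (B : EpsHermitianForm D V ε) {u v : V}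
    (huv : B.form u u = B.form v v) (hne : B.form u (u - v) ≠ 0) :
    ∃ g : B.isometryGroup, (g : V ≃ₗ[Dᵐᵒᵖ] V) u = v ∧
      ∀ x, B.form x (u - v) = 0 → (g : V ≃ₗ[Dᵐᵒᵖ] V) x = x := by
  obtain ⟨w, hw⟩ : ∃ w, w = u - v := ⟨_, rfl⟩
  rw [← hw] at hne ⊢
  obtain ⟨a, ha⟩ : ∃ a, a = B.form u w := ⟨_, rfl⟩
  rw [← ha] at hne
  let f : V →ₗ[Dᵐᵒᵖ] V :=
    { toFun := fun x => x - MulOpposite.op (a⁻¹ * B.form x w) • w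
      map_add' := fun x y => by
        rw [form_add_left, mul_add, MulOpposite.op_add, add_smul]
        abel
      map_smul' := fun c x => by
        obtain ⟨c, rfl⟩ := MulOpposite.op_surjective c
        rw [B.smul_left, ← mul_assoc, MulOpposite.op_mul, mul_smul, RingHom.id_apply, smul_sub] }
  have hf : ∀ x, f x = x - MulOpposite.op (a⁻¹ * B.form x w) • w := fun x => rfl
  -- the relation `ε a* + a = ⟨w, w⟩` is what makes the quasi-reflection an isometry
  have hww : B.form w w = ((ε : ℤ) : D) * star a + a := by
    rw [ha, ← B.hermitian w u, hw, form_sub_left, map_sub, map_sub, form_sub_left, huv]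
    abel
  have hsa : star a ≠ 0 := by simpa using hne
  obtain ⟨g, hg⟩ := B.exists_isometry_of_linearMap f fun x y => by
    rw [hf, hf, form_sub_left, map_sub, map_sub, B.smul_left, B.smul_left, B.smul_right,
      B.smul_right, hww, B.hermitian w y, star_mul, star_inv₀]
    set p := B.form x w
    set q := star (B.form y w)
    have e1 : q * (star a)⁻¹ * (((ε : ℤ) : D) * star a + a) * (a⁻¹ * p) =
        ((ε : ℤ) : D) * q * (a⁻¹ * p) + q * (star a)⁻¹ * p := by
      rw [mul_assoc (q * _)]
      have c1 : q * (star a)⁻¹ * (((ε : ℤ) : D) * star a * (a⁻¹ * p)) =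
          ((ε : ℤ) : D) * q * (a⁻¹ * p) := by
        rw [(Int.cast_commute (ε : ℤ) (star a)).eq, (Int.cast_commute (ε : ℤ) q).eq]
        simp only [mul_assoc]
        rw [inv_mul_cancel_left₀ hsa]
      rw [add_mul, mul_add, c1, mul_inv_cancel_left₀ hne]
    rw [e1]
    abel
  refine ⟨g, ?_, fun x hx => ?_⟩
  · rw [hg, hf, ← ha, inv_mul_cancel₀ hne, MulOpposite.op_one, one_smul, hw, sub_sub_cancel]
  · rw [hg, hf, hx, mul_zero, MulOpposite.op_zero, zero_smul, sub_zero]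

/-- An anisotropic vector `u` can be moved to any vector `v` of the same length by an isometry
fixing the orthogonal complement of `u` and `v`. -/
theorem exists_isometry_map_of_anisotropic (h2 : (2 : D) ≠ 0) (B : EpsHermitianForm D V ε)
    {u v : V} (huv : B.form u u = B.form v v) (hu : B.form u u ≠ 0) :
    ∃ g : B.isometryGroup, (g : V ≃ₗ[Dᵐᵒᵖ] V) u = v ∧
      ∀ x, B.form x u = 0 → B.form x v = 0 → (g : V ≃ₗ[Dᵐᵒᵖ] V) x = x := by
  by_cases h1 : B.form u (u - v) = 0
  · -- then `⟨u, u + v⟩ = 2⟨u, u⟩ ≠ 0`: move `u` to `-v`, then reflect in `v`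
    have h1' : B.form u v = B.form u u := by
      rw [map_sub, sub_eq_zero] at h1
      exact h1.symm
    obtain ⟨g, hg, hgx⟩ := B.exists_quasiReflection (u := u) (v := -v)
      (by rw [huv, form_neg_left, map_neg, neg_neg])
      (by rw [sub_neg_eq_add, map_add, h1', ← two_mul]; exact mul_ne_zero h2 hu)
    obtain ⟨s, hs, hsx⟩ := B.exists_quasiReflection (u := -v) (v := v)
      (by rw [form_neg_left, map_neg, neg_neg])
      (by
        rw [map_sub, map_neg, form_neg_left, ← huv, neg_neg, sub_neg_eq_add, ← two_mul]
        exact mul_ne_zero h2 hu)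
    refine ⟨s * g, ?_, fun x hxu hxv => ?_⟩
    · rw [Subgroup.coe_mul, LinearEquiv.mul_apply, hg, hs]
    · rw [Subgroup.coe_mul, LinearEquiv.mul_apply, hgx x (by simp [hxu, hxv]),
        hsx x (by simp [hxv])]
  · obtain ⟨g, hg, hgx⟩ := B.exists_quasiReflection huv h1
    exact ⟨g, hg, fun x hxu hxv => hgx x (by rw [map_sub, hxu, hxv, sub_zero])⟩

/-- One step of Witt's theorem for an alternating form. -/
theorem exists_isometry_map_of_alternating (B : EpsHermitianForm D V ε)
    (halt : ∀ x, B.form x x = 0) {W : Submodule Dᵐᵒᵖ V} {u v : V} (hu : u ∉ W) (hv : v ∉ W)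
    (huv : ∀ x ∈ W, B.form x u = B.form x v) :
    ∃ g : B.isometryGroup, (g : V ≃ₗ[Dᵐᵒᵖ] V) u = v ∧
      ∀ x ∈ W, (g : V ≃ₗ[Dᵐᵒᵖ] V) x = x := by
  by_cases h1 : B.form u v = 0
  · -- choose `y` orthogonal to `W` but neither to `u` nor to `v`, and pass through `u + y`
    obtain ⟨y, hyW, hyu, hyv⟩ : ∃ y, (∀ x ∈ W, B.form x y = 0) ∧ B.form u y ≠ 0 ∧
        B.form v y ≠ 0 := by
      obtain ⟨y, hyW, hy⟩ := B.exists_orthogonal_of_notMem hu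
      obtain ⟨z, hzW, hz⟩ := B.exists_orthogonal_of_notMem hv
      by_cases hy' : B.form v y = 0
      · by_cases hz' : B.form u z = 0
        · refine ⟨y + z, fun x hx => by rw [map_add, hyW x hx, hzW x hx, add_zero], ?_, ?_⟩
          · rwa [map_add, hz', add_zero]
          · rwa [map_add, hy', zero_add]
        · exact ⟨z, hzW, hz', hz⟩
      · exact ⟨y, hyW, hy, hy'⟩
    obtain ⟨g, hg, hgx⟩ := B.exists_quasiReflection (u := u) (v := u + y)
      (by rw [halt, halt]) (by rwa [sub_add_cancel_left, map_neg, neg_ne_zero])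
    obtain ⟨s, hs, hsx⟩ := B.exists_quasiReflection (u := u + y) (v := v)
      (by rw [halt, halt]) (by
        rw [map_sub, halt, zero_sub, neg_ne_zero, form_add_left, h1, zero_add]
        exact fun h0 => hyv (B.form_eq_zero_symm h0))
    refine ⟨s * g, ?_, fun x hx => ?_⟩
    · rw [Subgroup.coe_mul, LinearEquiv.mul_apply, hg, hs]
    · rw [Subgroup.coe_mul, LinearEquiv.mul_apply, hgx x (by simp [hyW x hx]),
        hsx x (by simp [hyW x hx, huv x hx])]
  · obtain ⟨g, hg, hgx⟩ := B.exists_quasiReflection (u := u) (v := v) (by rw [halt, halt])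
      (by rwa [map_sub, halt, zero_sub, neg_ne_zero])
    exact ⟨g, hg, fun x hx => hgx x (by rw [map_sub, huv x hx, sub_self])⟩

/-- Witt's theorem for an alternating form and an arbitrary subspace. -/
theorem exists_isometry_extension_of_alternating (B : EpsHermitianForm D V ε)
    (halt : ∀ x, B.form x x = 0) (W : Submodule Dᵐᵒᵖ V) (f : V →ₗ[Dᵐᵒᵖ] V)
    (hinj : ∀ x ∈ W, f x = 0 → x = 0)
    (hf : ∀ x ∈ W, ∀ y ∈ W, B.form (f x) (f y) = B.form x y) :
    ∃ g : B.isometryGroup, ∀ x ∈ W, (g : V ≃ₗ[Dᵐᵒᵖ] V) x = f x := by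
  -- a maximal subspace of `W` on which `f` agrees with an isometry is all of `W`
  let S : Set (Submodule Dᵐᵒᵖ V) :=
    {U | U ≤ W ∧ ∃ g : B.isometryGroup, ∀ x ∈ U, (g : V ≃ₗ[Dᵐᵒᵖ] V) x = f x}
  have hS : S.Nonempty := ⟨⊥, bot_le, 1, fun x hx => by
    rw [(Submodule.mem_bot _).mp hx, map_zero, map_zero]⟩
  obtain ⟨U, ⟨hUW, g, hg⟩, hmax⟩ := wellFounded_gt.has_min S hS
  by_cases hWU : W ≤ U
  · exact ⟨g, fun x hx => hg x (hWU hx)⟩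
  obtain ⟨u, huW, huU⟩ := Set.not_subset.mp hWU
  have hgg : ∀ x, (g : V ≃ₗ[Dᵐᵒᵖ] V) ((g : V ≃ₗ[Dᵐᵒᵖ] V).symm x) = x :=
    fun x => LinearEquiv.apply_symm_apply _ x
  obtain ⟨k, hk, hkU⟩ := B.exists_isometry_map_of_alternating halt (W := U) (u := u)
    (v := (g : V ≃ₗ[Dᵐᵒᵖ] V).symm (f u)) huU
    (fun hmem => by
      have h1 := hg _ hmem
      rw [hgg] at h1
      have h2 := hinj (u - (g : V ≃ₗ[Dᵐᵒᵖ] V).symm (f u)) (W.sub_mem huW (hUW hmem))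
        (by rw [map_sub, ← h1, sub_self])
      rw [← sub_eq_zero.mp h2] at hmem
      exact huU hmem)
    (fun x hx => by
      rw [← hf x (hUW hx) u huW, ← g.2 x, hgg, hg x hx])
  refine absurd ?_ (hmax (U ⊔ Submodule.span Dᵐᵒᵖ {u}) ⟨?_, g * k, ?_⟩)
  · show U < U ⊔ Submodule.span Dᵐᵒᵖ {u}
    refine lt_of_le_of_ne le_sup_left fun h => huU ?_
    rw [h]
    exact Submodule.mem_sup_right (Submodule.mem_span_singleton_self u)
  · exact sup_le hUW ((Submodule.span_singleton_le_iff_mem _ _).mpr huW)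
  · intro x hx
    obtain ⟨y, hy, z, hz, rfl⟩ := Submodule.mem_sup.mp hx
    obtain ⟨a, rfl⟩ := Submodule.mem_span_singleton.mp hz
    rw [Subgroup.coe_mul, LinearEquiv.mul_apply, map_add, map_smul, hk, hkU y hy, map_add,
      map_smul, hgg, hg y hy, map_add, map_smul]

/-- Witt's theorem: an isometric map on a non-degenerate subspace extends to the whole space. -/
theorem exists_isometry_extension (h2 : (2 : D) ≠ 0) (B : EpsHermitianForm D V ε)
    (W : Submodule Dᵐᵒᵖ V) (hW : B.IsNondegenerateSubspace W) (f : V →ₗ[Dᵐᵒᵖ] V)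
    (hf : ∀ x ∈ W, ∀ y ∈ W, B.form (f x) (f y) = B.form x y) :
    ∃ g : B.isometryGroup, ∀ x ∈ W, (g : V ≃ₗ[Dᵐᵒᵖ] V) x = f x := by
  induction hn : Module.finrank Dᵐᵒᵖ W using Nat.strong_induction_on generalizing W with
  | _ n ih =>
  by_cases hbot : W = ⊥
  · refine ⟨1, fun x hx => ?_⟩
    rw [hbot, Submodule.mem_bot] at hx
    rw [hx, map_zero, map_zero]
  by_cases halt : ∀ x ∈ W, B.form x x = 0
  · refine B.exists_isometry_extension_of_alternating
      (B.alternating_of_alternating_on h2 hW hbot halt) W f (fun x hx h0 => ?_) hf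
    exact hW x hx fun y hy => by rw [← hf x hx y hy, h0, map_zero, AddMonoidHom.zero_apply]
  -- split off an anisotropic vector `u` and extend from its orthogonal complement `U` in `W`
  push Not at halt
  obtain ⟨u, hu, huu⟩ := halt
  let U : Submodule Dᵐᵒᵖ V := W ⊓ LinearMap.ker (B.toFunctional u)
  have hU : ∀ x, x ∈ U ↔ x ∈ W ∧ B.form x u = 0 := fun x => Iff.rfl
  have hdec : ∀ x ∈ W, x - MulOpposite.op ((B.form u u)⁻¹ * B.form x u) • u ∈ U := fun x hx => by
    refine (hU _).mpr ⟨W.sub_mem hx (W.smul_mem _ hu), ?_⟩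
    rw [form_sub_left, B.smul_left, mul_inv_cancel_left₀ huu, sub_self]
  have hlt : Module.finrank Dᵐᵒᵖ U < n := by
    rw [← hn]
    refine Submodule.finrank_lt_finrank_of_lt (lt_of_le_of_ne inf_le_left fun h => huu ?_)
    exact ((hU u).mp (h ▸ hu)).2
  obtain ⟨g, hg⟩ := ih _ hlt U (fun x hx hxU => by
      refine hW x hx.1 fun y hy => ?_
      have h := hxU _ (hdec y hy)
      rw [map_sub, B.smul_right, (hU x).mp hx |>.2, mul_zero, sub_zero] at h
      exact h) (fun x hx y hy => hf x hx.1 y hy.1) rfl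
  have hgg : ∀ x, (g : V ≃ₗ[Dᵐᵒᵖ] V) ((g : V ≃ₗ[Dᵐᵒᵖ] V).symm x) = x :=
    fun x => LinearEquiv.apply_symm_apply _ x
  obtain ⟨k, hk, hkx⟩ := B.exists_isometry_map_of_anisotropic h2 (u := u)
    (v := (g : V ≃ₗ[Dᵐᵒᵖ] V).symm (f u)) (by rw [← g.2 (LinearEquiv.symm _ _), hgg, hf u hu u hu]) huu
  have hkU : ∀ x ∈ U, (g : V ≃ₗ[Dᵐᵒᵖ] V) ((k : V ≃ₗ[Dᵐᵒᵖ] V) x) = f x := fun x hx => by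
    rw [hkx x hx.2, hg x hx]
    rw [← g.2, hgg, hg x hx, hf x hx.1 u hu]
    exact hx.2
  refine ⟨g * k, fun x hx => ?_⟩
  rw [Subgroup.coe_mul, LinearEquiv.mul_apply]
  have h := hkU _ (hdec x hx)
  simpa only [map_sub, map_smul, hk, hgg, sub_left_inj] using h

end Witt

end EpsHermitianForm

/-! ### Representations of `sl₂` -/

section SlTwo

open Polynomial

/-- Operators `X`, `H`, `Y` in an associative ring which satisfy the relations of `sl₂`. -/
structure IsSlTwoRelation {A : Type*} [Ring A] (X H Y : A) : Prop where
  H_mul_X : H * X = X * (H + 2)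
  H_mul_Y : H * Y = Y * (H - 2)
  X_mul_Y : X * Y = Y * X + H

namespace IsSlTwoRelation

/-- The Casimir operator, normalized so that it acts as `n ^ 2` on an irreducible representation of
dimension `n`. -/
def casimir {A : Type*} [Ring A] (X H Y : A) : A := (H + 1) ^ 2 + 4 * (Y * X)

section Ring

variable {A : Type*} [Ring A] {X H Y : A}

theorem casimir_eq (h : IsSlTwoRelation X H Y) : casimir X H Y = (H - 1) ^ 2 + 4 * (X * Y) := by
  rw [h.X_mul_Y, casimir]
  noncomm_ring

theorem commute_casimir_X (h : IsSlTwoRelation X H Y) : Commute (casimir X H Y) X := by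
  have e1 : (H - 1) ^ 2 * X = X * (H + 1) ^ 2 := by
    have : (H - 1) * X = X * (H + 1) := by rw [sub_mul, h.H_mul_X]; noncomm_ring
    rw [pow_two, mul_assoc, this, ← mul_assoc, this, mul_assoc, ← pow_two]
  have e2 : casimir X H Y * X = (H - 1) ^ 2 * X + 4 * (X * Y * X) := by
    rw [h.casimir_eq]; noncomm_ring
  rw [Commute, SemiconjBy, e2, e1, casimir]
  noncomm_ring

theorem commute_casimir_H (h : IsSlTwoRelation X H Y) : Commute (casimir X H Y) H := by
  have e : H * (Y * X) = Y * X * H := by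
    rw [← mul_assoc, h.H_mul_Y, mul_assoc, sub_mul, h.H_mul_X]
    noncomm_ring
  have e2 : H * casimir X H Y = H * (H + 1) ^ 2 + 4 * (H * (Y * X)) := by
    rw [casimir]; noncomm_ring
  rw [Commute, SemiconjBy, e2, e, casimir]
  noncomm_ring

theorem X_mul_Y_pow (h : IsSlTwoRelation X H Y) (m : ℕ) :
    X * Y ^ (m + 1) = Y ^ (m + 1) * X + ((m : A) + 1) * (Y ^ m * (H - m)) := by
  induction m with
  | zero => simp [h.X_mul_Y]
  | succ m ih =>
    have e : (H - (m : A)) * Y = Y * (H - 2 - m) := by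
      rw [sub_mul, h.H_mul_Y, (Nat.cast_commute m Y).eq, ← mul_sub]
    have c : Y ^ (m + 1) * (m : A) = m * Y ^ (m + 1) := (Nat.cast_commute m _).eq.symm
    calc X * Y ^ (m + 1 + 1) = X * Y ^ (m + 1) * Y := by rw [pow_succ _ (m + 1), mul_assoc]
      _ = Y ^ (m + 1) * (X * Y) + ((m : A) + 1) * (Y ^ m * ((H - m) * Y)) := by
        rw [ih]; noncomm_ring
      _ = Y ^ (m + 1) * Y * X + (Y ^ (m + 1) * H +
            ((m : A) + 1) * (Y ^ (m + 1) * (H - 2 - m))) := by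
        rw [h.X_mul_Y, e, ← mul_assoc (Y ^ m), ← pow_succ]; noncomm_ring
      _ = _ := by
        rw [← pow_succ]
        congr 1
        push_cast
        simp only [mul_sub, mul_add, add_mul, c, one_mul, mul_one]
        have c2 : Y ^ (m + 1) * 2 = 2 * Y ^ (m + 1) := by noncomm_ring
        rw [c2]
        noncomm_ring

theorem conj (h : IsSlTwoRelation X H Y) {a b : A} (hba : b * a = 1) :
    IsSlTwoRelation (a * (X * b)) (a * (H * b)) (a * (Y * b)) := by
  have key : ∀ P Q : A, a * (P * b) * (a * (Q * b)) = a * (P * Q * b) := fun P Q => by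
    have : b * (a * (Q * b)) = Q * b := by rw [← mul_assoc, hba, one_mul]
    rw [mul_assoc, mul_assoc, this, mul_assoc]
  refine ⟨?_, ?_, ?_⟩
  · rw [mul_add, key, key, h.H_mul_X]
    noncomm_ring
  · rw [mul_sub, key, key, h.H_mul_Y]
    noncomm_ring
  · rw [key, key, h.X_mul_Y]
    noncomm_ring

theorem X_mul_H (h : IsSlTwoRelation X H Y) : X * H = (H - 2) * X := by
  rw [sub_mul, h.H_mul_X]
  noncomm_ring

end Ring

/-- An eigenvector of `ad h` with non-zero eigenvalue in a finite-dimensional algebra of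
characteristic zero is nilpotent. -/
theorem isNilpotent_of_commutator_eq_smul {F A : Type*} [Field F] [CharZero F] [Ring A]
    [Algebra F A] [Module.Finite F A] {h x : A} {c : F} (hc : c ≠ 0)
    (hx : h * x - x * h = c • x) : IsNilpotent x := by
  by_contra hnil
  let f : Module.End F A := LinearMap.mulLeft F h - LinearMap.mulRight F h
  have hf : ∀ n : ℕ, f (x ^ n) = ((n : F) * c) • x ^ n := fun n => by
    show h * x ^ n - x ^ n * h = _
    induction n with
    | zero => simp
    | succ n ih =>
      have e : h * x ^ (n + 1) - x ^ (n + 1) * h =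
          (h * x ^ n - x ^ n * h) * x + x ^ n * (h * x - x * h) := by
        rw [pow_succ]; noncomm_ring
      rw [e, ih, hx, smul_mul_assoc, mul_smul_comm, ← pow_succ, ← add_smul]
      congr 1
      push_cast
      ring
  have hev : ∀ n : ℕ, f.HasEigenvalue ((n : F) * c) := fun n =>
    Module.End.hasEigenvalue_of_hasEigenvector
      (x := x ^ n) ⟨Module.End.mem_eigenspace_iff.mpr (hf n), fun h0 => hnil ⟨n, h0⟩⟩
  have hinj : Function.Injective fun n : ℕ => (n : F) * c := fun m n hmn =>
    Nat.cast_injective (mul_right_cancel₀ hc hmn)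
  exact Set.infinite_of_injective_forall_mem hinj hev f.finite_hasEigenvalue

section Module

variable {F : Type*} [Field F] {R : Type*} [Ring R] [Algebra F R]
  {M : Type*} [AddCommGroup M] [Module F M] [Module R M] [IsScalarTower F R M]
  {X H Y : Module.End R M}

theorem aeval_H_mul_X (h : IsSlTwoRelation X H Y) (s : Finset ℤ) :
    aeval H (∏ k ∈ s, (Polynomial.X - C (k : F))) * X =
      X * aeval H (∏ k ∈ s, (Polynomial.X - C ((k - 2 : ℤ) : F))) := by
  classical
  induction s using Finset.induction_on with
  | empty => simp
  | insert a s ha ih =>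
    rw [Finset.prod_insert ha, Finset.prod_insert ha, map_mul, map_mul, mul_assoc, ih,
      ← mul_assoc, ← mul_assoc]
    congr 1
    have e1 : aeval H (Polynomial.X - C (a : F)) = H - (a : Module.End R M) := by simp
    have e2 : aeval H (Polynomial.X - C ((a - 2 : ℤ) : F)) = H - (a - 2) := by simp [map_ofNat]
    rw [e1, e2, sub_mul, h.H_mul_X, (Int.cast_commute a X).eq]
    noncomm_ring

variable [CharZero F]

variable (F) in
theorem isNilpotent_X [Module.Finite F M] (h : IsSlTwoRelation X H Y) : IsNilpotent X := by
  have : Module.Finite F (Module.End R M) :=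
    Module.Finite.of_injective (LinearMap.restrictScalarsₗ F R M M F)
      (LinearMap.restrictScalars_injective F)
  refine isNilpotent_of_commutator_eq_smul (F := F) (h := H) (c := 2)
    two_ne_zero ?_
  rw [h.H_mul_X, two_smul]
  noncomm_ring

variable (F) in
theorem isNilpotent_Y [Module.Finite F M] (h : IsSlTwoRelation X H Y) : IsNilpotent Y := by
  have : Module.Finite F (Module.End R M) :=
    Module.Finite.of_injective (LinearMap.restrictScalarsₗ F R M M F)
      (LinearMap.restrictScalars_injective F)
  refine isNilpotent_of_commutator_eq_smul (F := F) (h := H) (c := -2)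
    (neg_ne_zero.mpr two_ne_zero) ?_
  rw [h.H_mul_Y, neg_smul, two_smul]
  noncomm_ring

/-- On the kernel of `X` the operator `H` is killed by `t (t - 1) ⋯ (t - (m - 1))` as soon as `Y`
has nilpotency order at most `m` there. -/
theorem aeval_H_eq_zero_of_X_eq_zero (h : IsSlTwoRelation X H Y) (m : ℕ) {v : M} (hX : X v = 0)
    (hY : (Y ^ m) v = 0) :
    aeval H (∏ i ∈ Finset.range m, (Polynomial.X - C (i : F))) v = 0 := by
  induction m generalizing v with
  | zero => simpa using hY
  | succ m ih =>
    rw [Finset.prod_range_succ, aeval_mul, Module.End.mul_apply]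
    have e : aeval H (Polynomial.X - C (m : F)) v = (H - (m : Module.End R M)) v := by
      simp
    rw [e]
    refine ih ?_ ?_
    · have := LinearMap.congr_fun h.X_mul_H v
      rw [Module.End.mul_apply, Module.End.mul_apply, hX, map_zero] at this
      rw [LinearMap.sub_apply, map_sub, this, Module.End.natCast_apply, map_nsmul, hX, smul_zero,
        sub_zero]
    · have := LinearMap.congr_fun (h.X_mul_Y_pow m) v
      rw [Module.End.mul_apply, hY, map_zero, LinearMap.add_apply, Module.End.mul_apply _ X, hX,
        map_zero, zero_add, ← Nat.cast_succ, Module.End.mul_apply, Module.End.natCast_apply,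
        ← Nat.cast_smul_eq_nsmul F] at this
      have hm : ((m.succ : ℕ) : F) ≠ 0 := Nat.cast_ne_zero.mpr m.succ_ne_zero
      exact (smul_eq_zero.mp this.symm).resolve_left hm

/-- An operator killed on `v` by a polynomial with distinct integral roots decomposes `v` into
eigenvectors. -/
theorem mem_iSup_ker_of_aeval_prod_eq_zero (s : Finset ℤ) {v : M}
    (hv : aeval H (∏ k ∈ s, (Polynomial.X - C (k : F))) v = 0) :
    v ∈ ⨆ k : ℤ, LinearMap.ker (H - (k : Module.End R M)) := by
  classical
  induction s using Finset.induction_on generalizing v with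
  | empty =>
    rw [Finset.prod_empty, map_one, Module.End.one_apply] at hv
    rw [hv]
    exact Submodule.zero_mem _
  | insert a s ha ih =>
    rw [Finset.prod_insert ha] at hv
    set P := ∏ k ∈ s, (Polynomial.X - C (k : F)) with hP
    obtain ⟨p, q, hpq⟩ : IsCoprime (Polynomial.X - C (a : F)) P :=
      IsCoprime.prod_right fun k hk => isCoprime_X_sub_C_of_isUnit_sub
        (sub_ne_zero.mpr fun hak : (a : F) = k => ha (Int.cast_injective hak ▸ hk)).isUnit
    have hv' : v = aeval H (p * (Polynomial.X - C (a : F))) v + aeval H (q * P) v := by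
      rw [← LinearMap.add_apply, ← map_add, hpq, map_one, Module.End.one_apply]
    rw [hv']
    refine Submodule.add_mem _ (ih ?_) (Submodule.mem_iSup_of_mem a ?_)
    · rw [← Module.End.mul_apply, ← map_mul,
        show P * (p * (Polynomial.X - C (a : F))) = p * ((Polynomial.X - C (a : F)) * P) by ring,
        map_mul, Module.End.mul_apply, hv, map_zero]
    · have e : H - (a : Module.End R M) = aeval H (Polynomial.X - C (a : F)) := by simp
      rw [LinearMap.mem_ker, e, ← Module.End.mul_apply, ← map_mul,
        show (Polynomial.X - C (a : F)) * (q * P) = q * ((Polynomial.X - C (a : F)) * P) by ring,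
        map_mul, Module.End.mul_apply, hv, map_zero]

theorem casimir_apply_of_X_eq_zero {v : M} (hX : X v = 0) :
    casimir X H Y v = ((H + 1) ^ 2 : Module.End R M) v := by
  rw [casimir, LinearMap.add_apply, ← mul_assoc, Module.End.mul_apply _ X, hX, map_zero, add_zero]

/-- Vectors of positive weight in a representation with `X` nilpotent are in the image of `X`. -/
theorem exists_X_eq_of_weight_pos (F : Type*) [Field F] [CharZero F] {R : Type*} [Ring R]
    [Algebra F R] {M : Type*} [AddCommGroup M] [Module F M] [Module R M] [IsScalarTower F R M]
    {X H Y : Module.End R M} (h : IsSlTwoRelation X H Y) {j : ℤ} (hj : 1 ≤ j) (r : ℕ) {u : M}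
    (hu : H u = j • u) (hr : (X ^ r) u = 0) : ∃ w, H w = (j - 2) • w ∧ X w = u := by
  have hXH : ∀ v : M, H (X v) = X (H v) + (2 : ℤ) • X v := fun v => by
    have := LinearMap.congr_fun h.H_mul_X v
    rw [mul_add, LinearMap.add_apply, mul_two, LinearMap.add_apply, Module.End.mul_apply,
      Module.End.mul_apply] at this
    rw [this, two_smul]
  have hYH : ∀ v : M, H (Y v) = Y (H v) - (2 : ℤ) • Y v := fun v => by
    have := LinearMap.congr_fun h.H_mul_Y v
    rw [mul_sub, LinearMap.sub_apply, mul_two, LinearMap.add_apply, Module.End.mul_apply,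
      Module.End.mul_apply] at this
    rw [this, two_smul]
  induction r generalizing u with
  | zero => exact ⟨0, by simp, by simpa using hr.symm⟩
  | succ r ih =>
    -- `X ^ r u` has highest weight `j + 2r`, so the Casimir operator acts on it by `c`
    set c : ℤ := (j + 2 * r + 1) ^ 2 with hc
    have hXr : ∀ r : ℕ, H ((X ^ r) u) = (j + 2 * r : ℤ) • (X ^ r) u := fun r => by
      induction r with
      | zero => simpa using hu
      | succ r ih =>
        rw [pow_succ', Module.End.mul_apply, hXH, ih, map_zsmul, ← add_smul]
        congr 1
        push_cast
        ring
    have hsq : ∀ (v : M) (a b : ℤ), H v = a • v →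
        ((H + (b : Module.End R M)) ^ 2) v = ((a + b) ^ 2) • v := fun v a b hv => by
      have e : (H + (b : Module.End R M)) v = (a + b) • v := by
        rw [LinearMap.add_apply, hv, Module.End.intCast_apply, add_smul]
      rw [pow_two, Module.End.mul_apply, e, map_zsmul, e, smul_smul, ← pow_two]
    have hcas : ∀ v : M, X v = 0 → H v = (j + 2 * r : ℤ) • v → casimir X H Y v = c • v := by
      intro v hXv hv
      rw [casimir_apply_of_X_eq_zero hXv, hc]
      simpa using hsq v _ 1 hv
    have hcu : casimir X H Y u = ((j - 1) ^ 2) • u + (4 : ℤ) • X (Y u) := by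
      have e := hsq u _ (-1) hu
      rw [Int.cast_neg, Int.cast_one, ← sub_eq_add_neg, ← sub_eq_add_neg] at e
      rw [h.casimir_eq, LinearMap.add_apply, e, Module.End.mul_apply, Module.End.mul_apply]
      congr 1
      exact (Nat.cast_smul_eq_nsmul ℤ 4 (X (Y u))).symm
    obtain ⟨w, hw, hXw⟩ := ih (u := casimir X H Y u - c • u)
      (by
        have := LinearMap.congr_fun h.commute_casimir_H.eq u
        rw [Module.End.mul_apply, Module.End.mul_apply, hu] at this
        rw [map_sub, ← this, map_zsmul, map_zsmul, hu, smul_sub, smul_comm c])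
      (by
        have := LinearMap.congr_fun (h.commute_casimir_X.pow_right r).eq u
        rw [Module.End.mul_apply, Module.End.mul_apply] at this
        rw [map_sub, ← this, map_zsmul, hcas _ (by rw [← Module.End.mul_apply, ← pow_succ', hr])
          (hXr r), sub_self])
    set d : ℤ := (j - 1) ^ 2 - c with hd
    have hd0 : d ≠ 0 := by
      have : d = -((2 * r + 2) * (2 * j + 2 * r)) := by rw [hd, hc]; ring
      rw [this]
      have : (0 : ℤ) < (2 * r + 2) * (2 * j + 2 * r) := by positivity
      exact neg_ne_zero.mpr this.ne'
    have hdF : ((d : ℤ) : F) ≠ 0 := Int.cast_ne_zero.mpr hd0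
    have hsm : ∀ (f : Module.End R M) (a : F) (v : M), f (a • v) = a • f v := fun f a v =>
      f.map_smul_of_tower a v
    refine ⟨(d : F)⁻¹ • (w - (4 : ℤ) • Y u), ?_, ?_⟩
    · rw [hsm, map_sub, hw, map_zsmul, hYH, hu, map_zsmul, smul_comm (j - 2) ((d : F)⁻¹)]
      congr 1
      module
    · rw [hsm, map_sub, hXw, hcu, map_zsmul, inv_smul_eq_iff₀ hdF, Int.cast_smul_eq_zsmul, hd]
      module

variable (F) in
/-- A finite-dimensional representation of `sl₂` is the sum of its integral weight spaces. -/
theorem mem_iSup_weightSpace [Module.Finite F M] (h : IsSlTwoRelation X H Y) (v : M) :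
    v ∈ ⨆ k : ℤ, LinearMap.ker (H - (k : Module.End R M)) := by
  classical
  obtain ⟨n, hn⟩ := h.isNilpotent_X F
  obtain ⟨m, hm⟩ := h.isNilpotent_Y F
  -- up to elements of the image of `X` only weights `≤ 0` remain
  have hpos : ∀ u ∈ ⨆ k : ℤ, LinearMap.ker (H - (k : Module.End R M)),
      ∃ w ∈ ⨆ k : ℤ, LinearMap.ker (H - (k : Module.End R M)), ∃ s : Finset ℤ, (∀ k ∈ s, k ≤ 0) ∧
        aeval H (∏ k ∈ s, (Polynomial.X - C (k : F))) (u - X w) = 0 := by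
    intro u hu
    induction hu using Submodule.iSup_induction' with
    | mem k u hu =>
      have hu' : H u = k • u := by
        rw [LinearMap.mem_ker, LinearMap.sub_apply, sub_eq_zero] at hu
        simpa using hu
      by_cases hk : 1 ≤ k
      · obtain ⟨w, hw, hXw⟩ := exists_X_eq_of_weight_pos F h hk n hu' (by rw [hn]; rfl)
        refine ⟨w, Submodule.mem_iSup_of_mem (k - 2) ?_, ∅, by simp, by simp [hXw]⟩
        rw [LinearMap.mem_ker, LinearMap.sub_apply, hw, Module.End.intCast_apply, sub_self]
      · refine ⟨0, Submodule.zero_mem _, {k}, by simpa using by lia, ?_⟩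
        simp [hu']
    | zero => exact ⟨0, Submodule.zero_mem _, ∅, by simp, by simp⟩
    | add u₁ u₂ _ _ h₁ h₂ =>
      obtain ⟨w₁, hw₁, s₁, hs₁, h₁⟩ := h₁
      obtain ⟨w₂, hw₂, s₂, hs₂, h₂⟩ := h₂
      have hdvd : ∀ (s t : Finset ℤ) (x : M), s ⊆ t →
          aeval H (∏ k ∈ s, (Polynomial.X - C (k : F))) x = 0 →
          aeval H (∏ k ∈ t, (Polynomial.X - C (k : F))) x = 0 := fun s t x hst hx => by
        rw [← Finset.prod_sdiff hst, aeval_mul, Module.End.mul_apply, hx, map_zero]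
      refine ⟨w₁ + w₂, Submodule.add_mem _ hw₁ hw₂, s₁ ∪ s₂, fun k hk => ?_, ?_⟩
      · rcases Finset.mem_union.mp hk with hk | hk
        · exact hs₁ k hk
        · exact hs₂ k hk
      · rw [map_add X, add_sub_add_comm, map_add, hdvd _ _ _ Finset.subset_union_left h₁,
          hdvd _ _ _ Finset.subset_union_right h₂, add_zero]
  have key : ∀ (r : ℕ) (v : M), (X ^ r) v = 0 →
      v ∈ ⨆ k : ℤ, LinearMap.ker (H - (k : Module.End R M)) := by
    intro r
    induction r with
    | zero =>
      intro v hv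
      rw [pow_zero, Module.End.one_apply] at hv
      rw [hv]
      exact Submodule.zero_mem _
    | succ r ih =>
      intro v hv
      obtain ⟨w, hw, s, hs, hsw⟩ := hpos (X v) (ih _ (by
        rw [← Module.End.mul_apply, ← pow_succ, hv]))
      rw [← sub_add_cancel v w]
      refine Submodule.add_mem _ ?_ hw
      rw [← map_sub, ← Module.End.mul_apply, h.aeval_H_mul_X, Module.End.mul_apply] at hsw
      have hz := h.aeval_H_eq_zero_of_X_eq_zero (F := F) m hsw (by rw [hm]; rfl)
      rw [← Module.End.mul_apply, ← map_mul] at hz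
      -- the roots `≥ 0` and the roots `≤ -2` are disjoint
      refine mem_iSup_ker_of_aeval_prod_eq_zero (F := F)
        ((Finset.range m).map Nat.castEmbedding ∪ s.map (Equiv.subRight (2 : ℤ)).toEmbedding) ?_
      rw [Finset.prod_union, Finset.prod_map, Finset.prod_map]
      · simpa using hz
      · rw [Finset.disjoint_left]
        intro k hk hk'
        obtain ⟨i, -, rfl⟩ := Finset.mem_map.mp hk
        obtain ⟨l, hl, hl'⟩ := Finset.mem_map.mp hk'
        have := hs l hl
        simp only [Equiv.coe_toEmbedding, Equiv.subRight_apply, Nat.castEmbedding_apply] at hl'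
        lia
  exact key n v (by rw [hn]; rfl)

variable (F) in
/-- There is a polynomial `N` in the Casimir operator which agrees with `H + 1` on the kernel of
`X`; it acts by `n` on the irreducible representations of dimension `n`. -/
theorem exists_aeval_casimir_eq [Module.Finite F M] (h : IsSlTwoRelation X H Y) :
    ∃ p : F[X], ∀ v : M, X v = 0 → aeval (casimir X H Y) p v = H v + v := by
  classical
  obtain ⟨m, hm⟩ := h.isNilpotent_Y F
  have hinj : Set.InjOn (fun i : ℕ => ((i : F) + 1) ^ 2) (Finset.range m : Finset ℕ) := by
    intro i _ j _ hij
    have h1 : (i + 1) ^ 2 = (j + 1) ^ 2 := by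
      have : (((i + 1) ^ 2 : ℕ) : F) = (((j + 1) ^ 2 : ℕ) : F) := by push_cast; exact hij
      exact_mod_cast this
    have := Nat.pow_left_injective (n := 2) (by norm_num) h1
    lia
  let p : F[X] := Lagrange.interpolate (Finset.range m) (fun i : ℕ => ((i : F) + 1) ^ 2)
    (fun i => (i : F) + 1)
  refine ⟨p, fun v hv => ?_⟩
  -- on the kernel of `X` the Casimir operator is `(H + 1) ^ 2`
  have hcas : aeval (casimir X H Y) p v =
      aeval H (p.comp ((Polynomial.X + 1) ^ 2)) v := by
    have hpow : ∀ n : ℕ, (casimir X H Y ^ n) v = (((H + 1) ^ 2 : Module.End R M) ^ n) v := fun n => by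
      induction n with
      | zero => rfl
      | succ n ih =>
        have hc : Commute ((H + 1) ^ 2) (casimir X H Y ^ n) :=
          ((h.commute_casimir_H.symm.add_left (Commute.one_left _)).pow_left 2).pow_right n
        rw [pow_succ, Module.End.mul_apply, casimir_apply_of_X_eq_zero hv, ← Module.End.mul_apply,
          ← hc.eq, Module.End.mul_apply, ih, ← Module.End.mul_apply, ← pow_succ']
    rw [aeval_comp, map_pow, map_add, aeval_X, map_one]
    generalize p = q
    induction q using Polynomial.induction_on' with
    | add q₁ q₂ h₁ h₂ => rw [map_add, LinearMap.add_apply, h₁, h₂, map_add, LinearMap.add_apply]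
    | monomial n a =>
      rw [aeval_monomial, aeval_monomial, Module.End.mul_apply, Module.End.mul_apply, hpow]
  have hdvd : (∏ i ∈ Finset.range m, (Polynomial.X - C (i : F))) ∣
      p.comp ((Polynomial.X + 1) ^ 2) - (Polynomial.X + 1) := by
    refine Finset.prod_dvd_of_coprime (fun i _ j _ hij => ?_) fun i hi => ?_
    · exact isCoprime_X_sub_C_of_isUnit_sub
        (sub_ne_zero.mpr fun hij' => hij (Nat.cast_injective hij')).isUnit
    · rw [dvd_iff_isRoot, IsRoot, eval_sub, eval_comp]
      have := Lagrange.eval_interpolate_at_node (fun i : ℕ => (i : F) + 1) hinj hi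
      simp only [eval_pow, eval_add, eval_X, eval_one]
      rw [sub_eq_zero]
      exact this
  obtain ⟨q, hq⟩ := hdvd
  have h0 : aeval H (p.comp ((Polynomial.X + 1) ^ 2) - (Polynomial.X + 1)) v = 0 := by
    rw [hq, mul_comm, map_mul, Module.End.mul_apply,
      h.aeval_H_eq_zero_of_X_eq_zero (F := F) m hv (by rw [hm]; rfl), map_zero]
  rw [map_sub, LinearMap.sub_apply, ← hcas, sub_eq_zero] at h0
  rw [h0]
  simp

end Module

end IsSlTwoRelation

end SlTwo

/-- In an `sl₂`-triple the third element is determined by the first two: a difference would be a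
primitive vector of weight `-2` for the adjoint representation. -/
theorem IsSlTwoRelation.unique_Y (F : Type*) {A : Type*} [Field F] [CharZero F] [Ring A]
    [Algebra F A] [Module.Finite F A] {X H Y₁ Y₂ : A} (h₁ : IsSlTwoRelation X H Y₁)
    (h₂ : IsSlTwoRelation X H Y₂) : Y₁ = Y₂ := by
  by_contra hne
  have hH : H ≠ 0 := by
    intro hH
    have e : ∀ Y : A, IsSlTwoRelation X H Y → Y = 0 := fun Y hY => by
      have := hY.H_mul_Y
      rw [hH, zero_mul, zero_sub, mul_neg, eq_comm, neg_eq_zero, mul_two, ← two_smul F] at this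
      exact (smul_eq_zero.mp this).resolve_left two_ne_zero
    exact hne ((e _ h₁).trans (e _ h₂).symm)
  have ht : IsSl2Triple H X Y₁ :=
    { h_ne_zero := hH
      lie_e_f := by rw [Ring.lie_def, h₁.X_mul_Y]; noncomm_ring
      lie_h_e_nsmul := by rw [Ring.lie_def, h₁.H_mul_X]; noncomm_ring
      lie_h_f_nsmul := by rw [Ring.lie_def, h₁.H_mul_Y]; noncomm_ring }
  have hp : ht.HasPrimitiveVectorWith (Y₁ - Y₂) (-2 : F) :=
    { ne_zero := sub_ne_zero.mpr hne
      lie_h := by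
        rw [Ring.lie_def, mul_sub, h₁.H_mul_Y, h₂.H_mul_Y, neg_smul, two_smul]
        noncomm_ring
      lie_e := by
        rw [Ring.lie_def, mul_sub, h₁.X_mul_Y, h₂.X_mul_Y]
        noncomm_ring }
  obtain ⟨n, hn⟩ := hp.exists_nat
  have : ((n + 2 : ℕ) : F) = 0 := by push_cast; rw [← hn]; ring
  exact absurd (Nat.cast_eq_zero.mp this) (by lia)

namespace EpsHermitianForm

/-! ### Triples of skew-adjoint operators -/

section Finite

theorem finite_of_finite_mulOpposite (F : Type*) [Field F] (D : Type*) [DivisionRing D]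
    [Algebra F D] [Module.Finite F D] (V : Type*) [AddCommGroup V] [Module F V] [Module Dᵐᵒᵖ V]
    [IsScalarTower F Dᵐᵒᵖ V] [Module.Finite Dᵐᵒᵖ V] : Module.Finite F V := by
  have : Module.Finite F Dᵐᵒᵖ := Module.Finite.equiv (MulOpposite.opLinearEquiv F)
  exact Module.Finite.trans Dᵐᵒᵖ V

variable {F : Type*} [Field F] {D : Type*} [DivisionRing D] [StarRing D] [Algebra F D]
  {hF : ∀ c : F, star (algebraMap F D c) = algebraMap F D c}
  {V : Type*} [AddCommGroup V] [Module F V] [Module Dᵐᵒᵖ V] [IsScalarTower F Dᵐᵒᵖ V] {ε : ℤˣ}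

theorem isSlTwoRelation {B : EpsHermitianForm D V ε} (γ : SlTwoTriple (B.lieAlgebra F hF)) :
    IsSlTwoRelation (γ.X : Module.End Dᵐᵒᵖ V) γ.H γ.Y := by
  have h1 := congrArg Subtype.val γ.lie_H_X
  have h2 := congrArg Subtype.val γ.lie_H_Y
  have h3 := congrArg Subtype.val γ.lie_X_Y
  rw [LieSubalgebra.coe_bracket, Ring.lie_def, sub_eq_iff_eq_add] at h1 h2 h3
  refine ⟨?_, ?_, ?_⟩
  · rw [h1, two_smul, AddMemClass.coe_add]
    noncomm_ring
  · rw [h2, neg_smul, two_smul, NegMemClass.coe_neg, AddMemClass.coe_add]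
    noncomm_ring
  · rw [h3, add_comm]

/-- Elements of the Lie algebra are skew-adjoint. -/
theorem form_lieAlgebra_apply (B : EpsHermitianForm D V ε) (Z : B.lieAlgebra F hF) (u v : V) :
    B.form ((Z : Module.End Dᵐᵒᵖ V) u) v = - B.form u ((Z : Module.End Dᵐᵒᵖ V) v) :=
  eq_neg_of_add_eq_zero_left (Z.2 u v)

/-- A polynomial with central coefficients fixed by the involution in a self-adjoint operator is
self-adjoint. -/
theorem form_aeval_apply (hF : ∀ c : F, star (algebraMap F D c) = algebraMap F D c)
    (B : EpsHermitianForm D V ε) {A : Module.End Dᵐᵒᵖ V}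
    (hA : ∀ u v, B.form (A u) v = B.form u (A v)) (p : Polynomial F) (u v : V) :
    B.form (Polynomial.aeval A p u) v = B.form u (Polynomial.aeval A p v) := by
  have hpow : ∀ (n : ℕ) (u v : V), B.form ((A ^ n) u) v = B.form u ((A ^ n) v) := fun n => by
    induction n with
    | zero => intro u v; rfl
    | succ n ih =>
      intro u v
      rw [pow_succ, Module.End.mul_apply, ih, hA, ← Module.End.mul_apply, ← pow_succ', pow_succ]
  induction p using Polynomial.induction_on' with
  | add q₁ q₂ h₁ h₂ =>
    rw [map_add, LinearMap.add_apply, LinearMap.add_apply, form_add_left, h₁, h₂, map_add]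
  | monomial n a =>
    rw [Polynomial.aeval_monomial, Module.End.mul_apply, Module.End.mul_apply,
      Module.algebraMap_end_apply, Module.algebraMap_end_apply]
    have e : ∀ w : V, a • w = MulOpposite.op (algebraMap F D a) • w := fun w => by
      rw [← MulOpposite.algebraMap_apply, algebraMap_smul]
    rw [e, e, B.smul_left, B.smul_right, hF, hpow, Algebra.commutes a (B.form u _)]

end Finite

/-! ### Adjoints and moment maps -/

section Adjoint

variable {D : Type*} [DivisionRing D] [StarRing D]
  {V : Type*} [AddCommGroup V] [Module Dᵐᵒᵖ V] [Module.Finite Dᵐᵒᵖ V]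
  {V' : Type*} [AddCommGroup V'] [Module Dᵐᵒᵖ V'] {ε ε' : ℤˣ}

theorem adjoint_eq (B : EpsHermitianForm D V ε) (B' : EpsHermitianForm D V' ε')
    {T : V →ₗ[Dᵐᵒᵖ] V'} {S : V' →ₗ[Dᵐᵒᵖ] V} (h : ∀ v v', B'.form (T v) v' = B.form v (S v')) :
    B.adjoint B' T = S :=
  LinearMap.ext fun v' => B.eq_of_forall_form_eq fun v => by rw [← adjoint_spec, h]

theorem map_eq_zero_iff_orthogonal (B : EpsHermitianForm D V ε) (B' : EpsHermitianForm D V' ε')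
    (T : V →ₗ[Dᵐᵒᵖ] V') (v : V) :
    T v = 0 ↔ ∀ v', B.form v (B.adjoint B' T v') = 0 := by
  refine ⟨fun h v' => ?_, fun h => B'.nondegenerate _ fun v' => ?_⟩
  · rw [← adjoint_spec, h, map_zero, AddMonoidHom.zero_apply]
  · rw [B.adjoint_spec, h]

/-- If the kernel of `T` is non-degenerate, then it is complementary to the image of `T*`. -/
theorem exists_eq_adjoint_add (B : EpsHermitianForm D V ε) (B' : EpsHermitianForm D V' ε')
    {T : V →ₗ[Dᵐᵒᵖ] V'}
    (hT : B.IsNondegenerateSubspace (LinearMap.range (B.adjoint B' T))) (v : V) :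
    ∃ v' k, T k = 0 ∧ v = B.adjoint B' T v' + k := by
  obtain ⟨w, ⟨v', rfl⟩, hw⟩ := B.exists_orthogonal_decomposition hT v
  refine ⟨v', v - B.adjoint B' T v', ?_, (add_sub_cancel _ _).symm⟩
  rw [B.map_eq_zero_iff_orthogonal B']
  exact fun x => B.form_eq_zero_symm (hw _ ⟨x, rfl⟩)

theorem isNondegenerateSubspace_range_adjoint (B : EpsHermitianForm D V ε)
    (B' : EpsHermitianForm D V' ε') {T : V →ₗ[Dᵐᵒᵖ] V'}
    (hT : B.IsNondegenerateSubspace (LinearMap.ker T)) :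
    B.IsNondegenerateSubspace (LinearMap.range (B.adjoint B' T)) := by
  rintro _ ⟨v', rfl⟩ h
  refine hT _ ?_ fun k hk => ?_
  · rw [LinearMap.mem_ker, B.map_eq_zero_iff_orthogonal B']
    exact fun x => h _ ⟨x, rfl⟩
  · exact B.form_eq_zero_symm ((B.map_eq_zero_iff_orthogonal B' T k).mp hk v')

theorem isNondegenerateSubspace_ker (B : EpsHermitianForm D V ε)
    (B' : EpsHermitianForm D V' ε') {T : V →ₗ[Dᵐᵒᵖ] V'}
    (hT : B.IsNondegenerateSubspace (LinearMap.range (B.adjoint B' T))) :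
    B.IsNondegenerateSubspace (LinearMap.ker T) := by
  intro u hu h
  refine B.nondegenerate u fun v => ?_
  obtain ⟨v', k, hk, rfl⟩ := B.exists_eq_adjoint_add B' hT v
  rw [map_add, (B.map_eq_zero_iff_orthogonal B' T u).mp hu, h k hk, add_zero]

theorem form_adjoint_adjoint (B : EpsHermitianForm D V ε) (B' : EpsHermitianForm D V' ε')
    (T : V →ₗ[Dᵐᵒᵖ] V') (u v : V') :
    B.form (B.adjoint B' T u) (B.adjoint B' T v) = B'.form (T (B.adjoint B' T u)) v :=
  (B.adjoint_spec B' T _ v).symm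

end Adjoint

/-! ### Uniqueness of the lift -/

section Lift

variable {F : Type*} [Field F] {D : Type*} [DivisionRing D] [StarRing D] [Algebra F D]
  {hF : ∀ c : F, star (algebraMap F D c) = algebraMap F D c}
  {V : Type*} [AddCommGroup V] [Module F V] [Module Dᵐᵒᵖ V] [IsScalarTower F Dᵐᵒᵖ V]
  [Module.Finite Dᵐᵒᵖ V]
  {V' : Type*} [AddCommGroup V'] [Module F V'] [Module Dᵐᵒᵖ V'] [IsScalarTower F Dᵐᵒᵖ V']
  {ε ε' : ℤˣ} {h : ε * ε' = -1}
  {B : EpsHermitianForm D V ε} {B' : EpsHermitianForm D V' ε'}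
  {γ : SlTwoTriple (B.lieAlgebra F hF)} {γ' : SlTwoTriple (B'.lieAlgebra F hF)}
  {T : V →ₗ[Dᵐᵒᵖ] V'}

theorem adjoint_map_of_mem_liftSet (hT : T ∈ liftSet B B' h γ γ') (v : V) :
    B.adjoint B' T (T v) = (γ.X : Module.End Dᵐᵒᵖ V) v :=
  LinearMap.congr_fun (congrArg Subtype.val hT.1) v

theorem map_adjoint_of_mem_liftSet (hT : T ∈ liftSet B B' h γ γ') (v : V') :
    T (B.adjoint B' T v) = (γ'.X : Module.End Dᵐᵒᵖ V') v :=
  LinearMap.congr_fun (congrArg Subtype.val hT.2.1) v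

/-- The kernel of `T*` is the kernel of `X'`. -/
theorem adjoint_eq_zero_iff_of_mem_liftSet (hT : T ∈ liftSet B B' h γ γ') (v : V') :
    B.adjoint B' T v = 0 ↔ (γ'.X : Module.End Dᵐᵒᵖ V') v = 0 := by
  rw [← map_adjoint_of_mem_liftSet hT]
  refine ⟨fun h0 => by rw [h0, map_zero], fun h0 => ?_⟩
  refine B.isNondegenerateSubspace_range_adjoint B' hT.2.2.2 _ ⟨v, rfl⟩ ?_
  rintro _ ⟨x, rfl⟩
  rw [form_adjoint_adjoint, h0, map_zero, AddMonoidHom.zero_apply]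

variable [CharZero F] [Module.Finite F D]

/-- As `V` is the sum of its weight spaces, `T` intertwines `H` with `H' - 1`. -/
theorem map_H_of_mem_liftSet (hT : T ∈ liftSet B B' h γ γ') (v : V) :
    T ((γ.H : Module.End Dᵐᵒᵖ V) v) = (γ'.H : Module.End Dᵐᵒᵖ V') (T v) - T v := by
  have := finite_of_finite_mulOpposite F D V
  have hv := (isSlTwoRelation γ).mem_iSup_weightSpace F v
  induction hv using Submodule.iSup_induction' with
  | mem k u hu =>
    have hu' : (γ.H : Module.End Dᵐᵒᵖ V) u = k • u := by
      rw [LinearMap.mem_ker, LinearMap.sub_apply, sub_eq_zero] at hu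
      simpa using hu
    have hTu : (γ'.H : Module.End Dᵐᵒᵖ V') (T u) = (k + 1) • T u := hT.2.2.1 k u hu'
    rw [hu', hTu, map_zsmul, add_smul, one_smul, add_sub_cancel_right]
  | zero => simp
  | add u₁ u₂ _ _ h₁ h₂ =>
    rw [map_add, map_add, h₁, h₂, map_add, map_add]
    abel

theorem H_adjoint_of_mem_liftSet (hT : T ∈ liftSet B B' h γ γ') (v : V') :
    (γ.H : Module.End Dᵐᵒᵖ V) (B.adjoint B' T v) =
      B.adjoint B' T ((γ'.H : Module.End Dᵐᵒᵖ V') v + v) := by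
  refine B.eq_of_forall_form_eq fun w => ?_
  rw [← neg_eq_iff_eq_neg.mpr (form_lieAlgebra_apply B γ.H w _), ← adjoint_spec,
    map_H_of_mem_liftSet hT, form_sub_left, form_lieAlgebra_apply, ← adjoint_spec, map_add]
  abel

/-- On the kernel of `T` the operator `H` vanishes. -/
theorem H_eq_zero_of_mem_liftSet (hT : T ∈ liftSet B B' h γ γ') {k : V} (hk : T k = 0) :
    (γ.H : Module.End Dᵐᵒᵖ V) k = 0 := by
  have hX : (γ.X : Module.End Dᵐᵒᵖ V) k = 0 := by
    rw [← adjoint_map_of_mem_liftSet hT, hk, map_zero]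
  -- `H k = X Y k` lies in the image of `T*`, which is orthogonal to the kernel of `T`
  have hH : (γ.H : Module.End Dᵐᵒᵖ V) k =
      B.adjoint B' T (T ((γ.Y : Module.End Dᵐᵒᵖ V) k)) := by
    have := LinearMap.congr_fun (isSlTwoRelation γ).X_mul_Y k
    rw [LinearMap.add_apply, Module.End.mul_apply, Module.End.mul_apply, hX, map_zero,
      zero_add] at this
    rw [← this, adjoint_map_of_mem_liftSet hT]
  refine hT.2.2.2 _ ?_ fun l hl => ?_
  · rw [LinearMap.mem_ker, map_H_of_mem_liftSet hT, hk, map_zero, sub_zero]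
  · rw [hH]
    exact B.form_eq_zero_symm ((B.map_eq_zero_iff_orthogonal B' T l).mp hl _)

/-- Two lifts of `γ'` differ by an isometry of `V`: the isometry `T₁* v ↦ T₂* v` extends to `V` by
Witt's theorem. -/
theorem exists_isometry_of_mem_liftSet {γ₁ γ₂ : SlTwoTriple (B.lieAlgebra F hF)}
    {T₁ T₂ : V →ₗ[Dᵐᵒᵖ] V'} (h₁ : T₁ ∈ liftSet B B' h γ₁ γ') (h₂ : T₂ ∈ liftSet B B' h γ₂ γ') :
    ∃ g : B.isometryGroup, (B.Ad g γ₁.X = γ₂.X ∧ B.Ad g γ₁.H = γ₂.H ∧ B.Ad g γ₁.Y = γ₂.Y) ∧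
      ∀ v, T₂ ((g : V ≃ₗ[Dᵐᵒᵖ] V) v) = T₁ v := by
  have hfinV := finite_of_finite_mulOpposite F D V
  have hD : CharZero D := charZero_of_injective_algebraMap (algebraMap F D).injective
  have hfin : Module.Finite F (Module.End Dᵐᵒᵖ V) :=
    Module.Finite.of_injective (LinearMap.restrictScalarsₗ F Dᵐᵒᵖ V V F)
      (LinearMap.restrictScalars_injective F)
  obtain ⟨j, hj⟩ := (B.adjoint B' T₁).exists_generalizedInverse
  have hf : ∀ v, B.adjoint B' T₂ (j (B.adjoint B' T₁ v)) = B.adjoint B' T₂ v := fun v => by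
    rw [← sub_eq_zero, ← map_sub, adjoint_eq_zero_iff_of_mem_liftSet h₂,
      ← adjoint_eq_zero_iff_of_mem_liftSet h₁, map_sub, hj, sub_self]
  obtain ⟨g, hg⟩ := B.exists_isometry_extension two_ne_zero _
    (B.isNondegenerateSubspace_range_adjoint B' h₁.2.2.2) (B.adjoint B' T₂ ∘ₗ j) (by
      rintro _ ⟨u, rfl⟩ _ ⟨v, rfl⟩
      rw [LinearMap.comp_apply, LinearMap.comp_apply, hf, hf, form_adjoint_adjoint,
        form_adjoint_adjoint, map_adjoint_of_mem_liftSet h₁, map_adjoint_of_mem_liftSet h₂])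
  have hgR : ∀ v, (g : V ≃ₗ[Dᵐᵒᵖ] V) (B.adjoint B' T₁ v) = B.adjoint B' T₂ v := fun v => by
    rw [hg _ ⟨v, rfl⟩, LinearMap.comp_apply, hf]
  have hTg : ∀ v, T₂ ((g : V ≃ₗ[Dᵐᵒᵖ] V) v) = T₁ v := fun v => by
    rw [← sub_eq_zero]
    refine B'.nondegenerate _ fun v' => ?_
    rw [form_sub_left, B.adjoint_spec, B.adjoint_spec, ← hgR, g.2, sub_self]
  -- an operator identity `g Z₁ = Z₂ g` means `Ad g Z₁ = Z₂`
  have hAd : ∀ Z₁ Z₂ : B.lieAlgebra F hF,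
      (∀ v, (g : V ≃ₗ[Dᵐᵒᵖ] V) ((Z₁ : Module.End Dᵐᵒᵖ V) v) =
        (Z₂ : Module.End Dᵐᵒᵖ V) ((g : V ≃ₗ[Dᵐᵒᵖ] V) v)) → B.Ad g Z₁ = Z₂ := fun Z₁ Z₂ hZ => by
    refine Subtype.ext (LinearMap.ext fun v => ?_)
    have := hZ ((g : V ≃ₗ[Dᵐᵒᵖ] V).symm v)
    rw [LinearEquiv.apply_symm_apply] at this
    exact this
  have hX : B.Ad g γ₁.X = γ₂.X := hAd _ _ fun v => by
    rw [← adjoint_map_of_mem_liftSet h₁, ← adjoint_map_of_mem_liftSet h₂, hgR, hTg]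
  have hH : B.Ad g γ₁.H = γ₂.H := hAd _ _ fun v => by
    obtain ⟨v', k, hk, rfl⟩ := B.exists_eq_adjoint_add B'
      (B.isNondegenerateSubspace_range_adjoint B' h₁.2.2.2) v
    rw [map_add, H_eq_zero_of_mem_liftSet h₁ hk, add_zero, H_adjoint_of_mem_liftSet h₁, hgR,
      map_add, map_add, map_add, H_eq_zero_of_mem_liftSet h₂ ((hTg k).trans hk), add_zero, hgR,
      H_adjoint_of_mem_liftSet h₂, map_add]
  refine ⟨g, ⟨hX, hH, ?_⟩, hTg⟩
  have hrel : IsSlTwoRelation (B.Ad g γ₁.X : Module.End Dᵐᵒᵖ V) (B.Ad g γ₁.H) (B.Ad g γ₁.Y) :=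
    (isSlTwoRelation γ₁).conj (a := (g : V ≃ₗ[Dᵐᵒᵖ] V).toLinearMap)
      (b := (g : V ≃ₗ[Dᵐᵒᵖ] V).symm.toLinearMap)
      (LinearMap.ext fun v => LinearEquiv.symm_apply_apply _ v)
  rw [hX, hH] at hrel
  exact Subtype.ext (hrel.unique_Y F (isSlTwoRelation γ₂))

end Lift

end EpsHermitianForm

namespace EpsHermitianForm

/-! ### The group action on lifts -/

section Action

variable {F : Type*} [Field F] {D : Type*} [DivisionRing D] [StarRing D] [Algebra F D]
  {hF : ∀ c : F, star (algebraMap F D c) = algebraMap F D c}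
  {V : Type*} [AddCommGroup V] [Module F V] [Module Dᵐᵒᵖ V] [IsScalarTower F Dᵐᵒᵖ V]
  [Module.Finite Dᵐᵒᵖ V]
  {V' : Type*} [AddCommGroup V'] [Module F V'] [Module Dᵐᵒᵖ V'] [IsScalarTower F Dᵐᵒᵖ V']
  {ε ε' : ℤˣ} {h : ε * ε' = -1}
  {B : EpsHermitianForm D V ε} {B' : EpsHermitianForm D V' ε'}
  {γ' : SlTwoTriple (B'.lieAlgebra F hF)}
  {T : V →ₗ[Dᵐᵒᵖ] V'}

theorem mem_liftSet_of_Ad_eq {γ₁ γ₂ : SlTwoTriple (B.lieAlgebra F hF)}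
    (hT : T ∈ liftSet B B' h γ₁ γ') {g : B.isometryGroup} (hX : B.Ad g γ₁.X = γ₂.X)
    (hH : B.Ad g γ₁.H = γ₂.H) {m' : B'.isometryGroup} (hm' : m' ∈ B'.tripleStabilizer γ') :
    (m' : V' ≃ₗ[Dᵐᵒᵖ] V').toLinearMap ∘ₗ T ∘ₗ (g : V ≃ₗ[Dᵐᵒᵖ] V).symm.toLinearMap ∈
      liftSet B B' h γ₂ γ' := by
  have hadj := B.adjoint_eq B' (T := (m' : V' ≃ₗ[Dᵐᵒᵖ] V').toLinearMap ∘ₗ T ∘ₗ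
      (g : V ≃ₗ[Dᵐᵒᵖ] V).symm.toLinearMap)
    (S := (g : V ≃ₗ[Dᵐᵒᵖ] V).toLinearMap ∘ₗ B.adjoint B' T ∘ₗ
      (m' : V' ≃ₗ[Dᵐᵒᵖ] V').symm.toLinearMap) (fun v v' => by
    have e1 := m'.2 (T ((g : V ≃ₗ[Dᵐᵒᵖ] V).symm v)) ((m' : V' ≃ₗ[Dᵐᵒᵖ] V').symm v')
    have e2 := g.2 ((g : V ≃ₗ[Dᵐᵒᵖ] V).symm v)
      (B.adjoint B' T ((m' : V' ≃ₗ[Dᵐᵒᵖ] V').symm v'))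
    rw [LinearEquiv.apply_symm_apply] at e1 e2
    exact e1.trans ((B.adjoint_spec B' _ _ _).trans e2.symm))
  refine ⟨?_, ?_, fun k v hv => ?_, fun u hu hker => ?_⟩
  · rw [← hX, ← hT.1]
    refine Subtype.ext (LinearMap.ext fun v => ?_)
    simp [momentMap, hadj, Ad]
  · conv_rhs => rw [← hm'.2, ← hT.2.1]
    refine Subtype.ext (LinearMap.ext fun v => ?_)
    simp [momentMap', hadj, Ad]
  · have hv1 : (γ₁.H : Module.End Dᵐᵒᵖ V) ((g : V ≃ₗ[Dᵐᵒᵖ] V).symm v) =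
        k • (g : V ≃ₗ[Dᵐᵒᵖ] V).symm v := by
      have hv2 : (γ₂.H : Module.End Dᵐᵒᵖ V) v = k • v := hv
      rw [← hH] at hv2
      have hv3 : (g : V ≃ₗ[Dᵐᵒᵖ] V) ((γ₁.H : Module.End Dᵐᵒᵖ V)
        ((g : V ≃ₗ[Dᵐᵒᵖ] V).symm v)) = k • v := hv2
      rw [← map_zsmul, ← hv3, LinearEquiv.symm_apply_apply]
    have hw : (γ'.H : Module.End Dᵐᵒᵖ V') (T ((g : V ≃ₗ[Dᵐᵒᵖ] V).symm v)) =
      (k + 1) • T ((g : V ≃ₗ[Dᵐᵒᵖ] V).symm v) := hT.2.2.1 k _ hv1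
    show (γ'.H : Module.End Dᵐᵒᵖ V')
      ((m' : V' ≃ₗ[Dᵐᵒᵖ] V') (T ((g : V ≃ₗ[Dᵐᵒᵖ] V).symm v))) =
      (k + 1) • (m' : V' ≃ₗ[Dᵐᵒᵖ] V') (T ((g : V ≃ₗ[Dᵐᵒᵖ] V).symm v))
    conv_lhs => rw [← hm'.1]
    show (m' : V' ≃ₗ[Dᵐᵒᵖ] V') ((γ'.H : Module.End Dᵐᵒᵖ V') ((m' : V' ≃ₗ[Dᵐᵒᵖ] V').symm
      ((m' : V' ≃ₗ[Dᵐᵒᵖ] V') (T ((g : V ≃ₗ[Dᵐᵒᵖ] V).symm v))))) = _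
    rw [LinearEquiv.symm_apply_apply, hw, map_zsmul]
  · have hk : ∀ x, ((m' : V' ≃ₗ[Dᵐᵒᵖ] V').toLinearMap ∘ₗ T ∘ₗ
        (g : V ≃ₗ[Dᵐᵒᵖ] V).symm.toLinearMap) x = 0 ↔ T ((g : V ≃ₗ[Dᵐᵒᵖ] V).symm x) = 0 :=
      fun x => (m' : V' ≃ₗ[Dᵐᵒᵖ] V').map_eq_zero_iff
    rw [← (g : V ≃ₗ[Dᵐᵒᵖ] V).symm.map_eq_zero_iff]
    refine hT.2.2.2 _ ((hk u).mp hu) fun l hl => ?_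
    rw [← g.2, LinearEquiv.apply_symm_apply]
    exact hker _ ((hk _).mpr (by rw [LinearEquiv.symm_apply_apply]; exact hl))

end Action

/-! ### Existence of a lift -/

section Existence

variable {F : Type*} [Field F] {D : Type*} [DivisionRing D] [StarRing D] [Algebra F D]
  {V : Type*} [AddCommGroup V] [Module Dᵐᵒᵖ V] [Module.Finite Dᵐᵒᵖ V]
  {V' : Type*} [AddCommGroup V'] [Module Dᵐᵒᵖ V'] {ε ε' : ℤˣ}

/-- Every element of the image of `φ'` is `φ'(T)` for some `T` with non-degenerate kernel, for
which the kernel of `T*` is the kernel of `φ'(T)`. If `X' = S S*`, this is the `T` with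
`T* = S* ∘ p`, where `p` is a projection along the kernel of `X'`. -/
theorem exists_map_with_nondegenerate_ker [Module F V'] [IsScalarTower F Dᵐᵒᵖ V']
    [Module.Finite Dᵐᵒᵖ V']
    (hF : ∀ c : F, star (algebraMap F D c) = algebraMap F D c)
    (h : ε * ε' = -1) (B : EpsHermitianForm D V ε) (B' : EpsHermitianForm D V' ε')
    (S : V →ₗ[Dᵐᵒᵖ] V') :
    ∃ T : V →ₗ[Dᵐᵒᵖ] V', momentMap' hF B B' h T = momentMap' hF B B' h S ∧
      B.IsNondegenerateSubspace (LinearMap.range (B.adjoint B' T)) ∧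
      ∀ v, T (B.adjoint B' T v) = 0 → B.adjoint B' T v = 0 := by
  set X' := momentMap' hF B B' h S with hX'
  have hS : ∀ v, (X' : Module.End Dᵐᵒᵖ V') v = S (B.adjoint B' S v) := fun v => rfl
  obtain ⟨j, hj⟩ := (X' : Module.End Dᵐᵒᵖ V').exists_generalizedInverse
  let R : V' →ₗ[Dᵐᵒᵖ] V := B.adjoint B' S ∘ₗ j ∘ₗ (X' : Module.End Dᵐᵒᵖ V')
  have hR : ∀ v, R v = B.adjoint B' S (j ((X' : Module.End Dᵐᵒᵖ V') v)) := fun v => rfl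
  -- the adjoint of `R` is its transpose up to sign
  let T : V →ₗ[Dᵐᵒᵖ] V' := -B'.adjoint B R
  have hTR : B.adjoint B' T = R := B.adjoint_eq B' fun v v' => by
    rw [LinearMap.neg_apply, form_neg_left, B'.adjoint_spec' B (by rw [mul_comm, h]), neg_neg]
  have hform : ∀ u v, B.form (R u) (R v) = B'.form ((X' : Module.End Dᵐᵒᵖ V') u) v := fun u v => by
    rw [hR, hR, form_adjoint_adjoint, ← hS, hj,
      form_lieAlgebra_apply, hj, ← form_lieAlgebra_apply]
  have hmom : ∀ v, T (R v) = (X' : Module.End Dᵐᵒᵖ V') v := fun v => by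
    rw [← sub_eq_zero]
    refine B'.nondegenerate _ fun w => ?_
    rw [form_sub_left, B.adjoint_spec B', hTR, hform, sub_self]
  refine ⟨T, Subtype.ext (LinearMap.ext fun v => ?_), ?_, fun v hv => ?_⟩
  · show T (B.adjoint B' T v) = _
    rw [hTR, hmom]
  · rw [hTR]
    rintro _ ⟨u, rfl⟩ hu
    have : (X' : Module.End Dᵐᵒᵖ V') u = 0 := B'.nondegenerate _ fun v => by
      rw [← hform]
      exact hu _ ⟨v, rfl⟩
    rw [hR, this, map_zero, map_zero]
  · rw [hTR] at hv ⊢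
    rw [hmom] at hv
    rw [hR, hv, map_zero, map_zero]

variable [Module F V] [IsScalarTower F Dᵐᵒᵖ V]

/-- An operator on `V'` which preserves the kernel of `T T*` is transported along `T*` to an
operator on `V` vanishing on the kernel of `T`. -/
theorem exists_lieAlgebra_intertwining
    (hF : ∀ c : F, star (algebraMap F D c) = algebraMap F D c)
    (B : EpsHermitianForm D V ε) (B' : EpsHermitianForm D V' ε') {T : V →ₗ[Dᵐᵒᵖ] V'}
    (hT : B.IsNondegenerateSubspace (LinearMap.range (B.adjoint B' T)))
    (hker : ∀ v, T (B.adjoint B' T v) = 0 → B.adjoint B' T v = 0)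
    (Z' : Module.End Dᵐᵒᵖ V')
    (hZ' : ∀ v, T (B.adjoint B' T v) = 0 → T (B.adjoint B' T (Z' v)) = 0)
    (hskew : ∀ u v, B'.form (T (B.adjoint B' T (Z' u))) v +
      B'.form (T (B.adjoint B' T u)) (Z' v) = 0) :
    ∃ Z : B.lieAlgebra F hF,
      (∀ v, (Z : Module.End Dᵐᵒᵖ V) (B.adjoint B' T v) = B.adjoint B' T (Z' v)) ∧
      ∀ k, T k = 0 → (Z : Module.End Dᵐᵒᵖ V) k = 0 := by
  obtain ⟨j, hj⟩ := (T ∘ₗ B.adjoint B' T).exists_generalizedInverse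
  simp only [LinearMap.comp_apply] at hj
  let Z : Module.End Dᵐᵒᵖ V := B.adjoint B' T ∘ₗ Z' ∘ₗ j ∘ₗ T
  have hZR : ∀ v, Z (B.adjoint B' T v) = B.adjoint B' T (Z' v) := fun v => by
    show B.adjoint B' T (Z' (j (T (B.adjoint B' T v)))) = _
    rw [← sub_eq_zero, ← map_sub, ← map_sub]
    exact hker _ (hZ' _ (by rw [map_sub, map_sub, hj, sub_self]))
  have hZk : ∀ k, T k = 0 → Z k = 0 := fun k hk => by
    show B.adjoint B' T (Z' (j (T k))) = 0
    rw [hk, map_zero, map_zero, map_zero]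
  refine ⟨⟨Z, fun u v => ?_⟩, hZR, hZk⟩
  obtain ⟨a, k, hk, rfl⟩ := B.exists_eq_adjoint_add B' hT u
  obtain ⟨b, l, hl, rfl⟩ := B.exists_eq_adjoint_add B' hT v
  rw [map_add Z, map_add Z, hZk k hk, hZk l hl, hZR, hZR, add_zero, add_zero, map_add,
    form_add_left, B.form_eq_zero_symm ((B.map_eq_zero_iff_orthogonal B' T l).mp hl _),
    (B.map_eq_zero_iff_orthogonal B' T k).mp hk, add_zero, add_zero, form_adjoint_adjoint,
    form_adjoint_adjoint, hskew]

/-- Vectors orthogonal to the kernel of a skew-adjoint operator lie in its image. -/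
theorem mem_range_of_orthogonal_ker {hF : ∀ c : F, star (algebraMap F D c) = algebraMap F D c}
    (B : EpsHermitianForm D V ε) (Z : B.lieAlgebra F hF) {w : V}
    (hw : ∀ v, (Z : Module.End Dᵐᵒᵖ V) v = 0 → B.form w v = 0) :
    w ∈ LinearMap.range (Z : Module.End Dᵐᵒᵖ V) := by
  by_contra hmem
  obtain ⟨y, hy, hwy⟩ := B.exists_orthogonal_of_notMem hmem
  refine hwy (hw y (B.nondegenerate_right _ fun u => ?_))
  rw [← neg_eq_iff_eq_neg.mpr (form_lieAlgebra_apply B Z u y), hy _ ⟨u, rfl⟩, neg_zero]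

/-- The operator `E = ((N - 1) ^ 2 - H ^ 2) / 4`, where `N` acts by `n` on the irreducible
representations of dimension `n`. It is the product `X Y₁`, where `Y₁` completes the operators
induced by `X` and `H + 1` on the quotient by the kernel of `X` to an `sl₂`-triple. -/
theorem exists_shifted_product [CharZero F] [Module.Finite F D]
    {hF : ∀ c : F, star (algebraMap F D c) = algebraMap F D c}
    (B : EpsHermitianForm D V ε) (γ : SlTwoTriple (B.lieAlgebra F hF)) :
    ∃ E : Module.End Dᵐᵒᵖ V,
      (γ.H : Module.End Dᵐᵒᵖ V) * E = E * γ.H ∧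
      (γ.X : Module.End Dᵐᵒᵖ V) * E = E * γ.X + γ.X * ((γ.H : Module.End Dᵐᵒᵖ V) + 1) ∧
      (∀ u v, B.form (E u) v = B.form u (E v)) ∧
      ∀ v, (γ.X : Module.End Dᵐᵒᵖ V) v = 0 → E v = 0 := by
  have hfin := finite_of_finite_mulOpposite F D V
  have hrel := isSlTwoRelation γ
  have hHs := form_lieAlgebra_apply B γ.H
  have hXs := form_lieAlgebra_apply B γ.X
  have hYs := form_lieAlgebra_apply B γ.Y
  set X := (γ.X : Module.End Dᵐᵒᵖ V)
  set H := (γ.H : Module.End Dᵐᵒᵖ V)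
  set Y := (γ.Y : Module.End Dᵐᵒᵖ V)
  obtain ⟨p, hp⟩ := hrel.exists_aeval_casimir_eq F
  set Ω := IsSlTwoRelation.casimir X H Y with hΩ
  set N := Polynomial.aeval Ω p with hN
  have hcomm : ∀ Z : Module.End Dᵐᵒᵖ V, Commute Ω Z → Commute N Z := fun Z hZ => by
    rw [hN, Polynomial.aeval_eq_sum_range]
    exact Commute.sum_left _ _ _ fun i _ => (hZ.pow_left i).smul_left _
  have hNX : Commute N X := hcomm X hrel.commute_casimir_X
  have hNH : Commute N H := hcomm H hrel.commute_casimir_H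
  have hΩs : ∀ u v, B.form (Ω u) v = B.form u (Ω v) := fun u v => by
    have e1 : Ω u = H (H u) + H u + H u + u + (4 : ℤ) • Y (X u) := by
      have : Ω = H * H + H + H + 1 + (4 : ℤ) • (Y * X) := by
        rw [hΩ, IsSlTwoRelation.casimir]; noncomm_ring
      rw [this]
      rfl
    have e2 : Ω v = H (H v) - H v - H v + v + (4 : ℤ) • X (Y v) := by
      have : Ω = H * H - H - H + 1 + (4 : ℤ) • (X * Y) := by
        rw [hΩ, hrel.casimir_eq]; noncomm_ring
      rw [this]
      rfl
    rw [e1, e2]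
    simp only [form_add_left, map_add (B.form u), map_sub (B.form u), map_zsmul,
      AddMonoidHom.zsmul_apply, hHs, hXs, hYs, neg_neg]
    abel
  have hNs : ∀ u v, B.form (N u) v = B.form u (N v) := form_aeval_apply hF B hΩs p
  -- `G = 4 E`, with `Ω` in place of `N ^ 2`
  set G : Module.End Dᵐᵒᵖ V := Ω + 1 - H ^ 2 - 2 * N with hG
  have hGH : H * G = G * H := by
    have e1 : H * Ω = Ω * H := hrel.commute_casimir_H.eq.symm
    have e2 : H * N = N * H := hNH.eq.symm
    have e3 : H * G = H * Ω + H - H ^ 2 * H - 2 * (H * N) := by rw [hG]; noncomm_ring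
    rw [e3, e1, e2, hG]
    noncomm_ring
  have hGX : X * G = G * X + 4 * (X * (H + 1)) := by
    have e1 : X * Ω = Ω * X := hrel.commute_casimir_X.eq.symm
    have e2 : X * N = N * X := hNX.eq.symm
    have e3 : X * G = X * Ω + X - X * H ^ 2 - 2 * (X * N) := by rw [hG]; noncomm_ring
    have e4 : H ^ 2 * X = X * (H + 2) ^ 2 := by
      rw [pow_two, mul_assoc, hrel.H_mul_X, ← mul_assoc, hrel.H_mul_X, mul_assoc, ← pow_two]
    have e5 : G * X = Ω * X + X - H ^ 2 * X - 2 * (N * X) := by rw [hG]; noncomm_ring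
    rw [e3, e1, e2, e5, e4]
    noncomm_ring
  have hGs : ∀ u v, B.form (G u) v = B.form u (G v) := fun u v => by
    have e : ∀ w, G w = Ω w + w - H (H w) - (N w + N w) := fun w => by
      rw [hG, two_mul, pow_two]
      rfl
    rw [e, e, form_sub_left, form_sub_left, form_add_left, form_add_left, hΩs, hNs, hHs, hHs,
      map_sub, map_sub, map_add, map_add, neg_neg]
  have hGk : ∀ v, X v = 0 → G v = 0 := fun v hv => by
    have e1 := IsSlTwoRelation.casimir_apply_of_X_eq_zero (H := H) (Y := Y) hv
    have e2 := hp v hv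
    simp only [hG, LinearMap.sub_apply, LinearMap.add_apply, two_mul, Module.End.one_apply]
    rw [hΩ, e1, hN, e2]
    simp only [pow_two, Module.End.mul_apply, LinearMap.add_apply, Module.End.one_apply, map_add]
    abel
  have h4 : (4 : F) ≠ 0 := by norm_num
  refine ⟨(4 : F)⁻¹ • G, ?_, ?_, fun u v => ?_, fun v hv => ?_⟩
  · rw [mul_smul_comm, hGH, smul_mul_assoc]
  · rw [mul_smul_comm, hGX, smul_mul_assoc, smul_add]
    congr 1
    rw [inv_smul_eq_iff₀ h4, ← map_ofNat (algebraMap F (Module.End Dᵐᵒᵖ V)) 4,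
      ← Algebra.smul_def]
  · have e : ∀ w : V, (4 : F)⁻¹ • w = MulOpposite.op (algebraMap F D (4 : F)⁻¹) • w :=
      fun w => by rw [← MulOpposite.algebraMap_apply, algebraMap_smul]
    rw [LinearMap.smul_apply, LinearMap.smul_apply, e, e, B.smul_left, B.smul_right, hF, hGs,
      Algebra.commutes _ (B.form u _)]
  · rw [LinearMap.smul_apply, hGk v hv, smul_zero]

/-- Every triple `γ'` whose nilpositive element is in the image of `φ'` is a lift of some triple
`γ`. -/
theorem exists_mem_liftSet [CharZero F] [Module.Finite F D] [Module F V']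
    [IsScalarTower F Dᵐᵒᵖ V'] [Module.Finite Dᵐᵒᵖ V']
    {hF : ∀ c : F, star (algebraMap F D c) = algebraMap F D c}
    (h : ε * ε' = -1) (B : EpsHermitianForm D V ε) (B' : EpsHermitianForm D V' ε')
    (γ' : SlTwoTriple (B'.lieAlgebra F hF))
    (hX' : ∃ S : V →ₗ[Dᵐᵒᵖ] V', momentMap' hF B B' h S = γ'.X) :
    ∃ (γ : SlTwoTriple (B.lieAlgebra F hF)) (T : V →ₗ[Dᵐᵒᵖ] V'), T ∈ liftSet B B' h γ γ' := by
  obtain ⟨S, hS⟩ := hX'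
  obtain ⟨T, hTS, hT, hker⟩ := exists_map_with_nondegenerate_ker hF h B B' S
  rw [hS] at hTS
  have hTR : ∀ v, T (B.adjoint B' T v) = (γ'.X : Module.End Dᵐᵒᵖ V') v :=
    LinearMap.congr_fun (congrArg Subtype.val hTS)
  obtain ⟨E, hEH, hEX, hEs, hEk⟩ := B'.exists_shifted_product γ'
  have hrel := isSlTwoRelation γ'
  have hHs := form_lieAlgebra_apply B' γ'.H
  have hXs := form_lieAlgebra_apply B' γ'.X
  have hEr : ∀ u, E u ∈ LinearMap.range (γ'.X : Module.End Dᵐᵒᵖ V') := fun u =>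
    B'.mem_range_of_orthogonal_ker γ'.X fun v hv => by rw [hEs, hEk v hv, map_zero]
  set R := B.adjoint B' T with hR
  set X' := (γ'.X : Module.End Dᵐᵒᵖ V')
  set H' := (γ'.H : Module.End Dᵐᵒᵖ V')
  have hHX : ∀ v, H' (X' v) = X' (H' v) + X' v + X' v := fun v => by
    have := LinearMap.congr_fun hrel.H_mul_X v
    rwa [mul_add, LinearMap.add_apply, mul_two, LinearMap.add_apply, Module.End.mul_apply,
      Module.End.mul_apply, ← add_assoc] at this
  -- `Y₁` is determined by `X' Y₁ = E` up to the kernel of `X'`, which is also that of `T*`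
  obtain ⟨j, hj⟩ := X'.exists_generalizedInverse
  let Y₁ : Module.End Dᵐᵒᵖ V' := j ∘ₗ E
  have hXY : ∀ v, X' (Y₁ v) = E v := fun v => by
    obtain ⟨w, hw⟩ := hEr v
    show X' (j (E v)) = E v
    rw [← hw, hj]
  have hRR : ∀ x y, X' x = X' y → R x = R y := fun x y hxy => by
    rw [← sub_eq_zero, ← map_sub]
    exact hker _ (by rw [hTR, map_sub, hxy, sub_self])
  obtain ⟨H, hHR, hHk⟩ := exists_lieAlgebra_intertwining hF B B' hT hker (H' + 1)
    (fun v hv => by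
      rw [← hR, hTR] at hv ⊢
      have := hHX v
      rw [hv, map_zero, add_zero, add_zero] at this
      rw [LinearMap.add_apply, map_add, ← this, Module.End.one_apply, hv, add_zero])
    (fun u v => by
      have e : X' (H' u + u) = H' (X' u) - X' u := by rw [hHX, map_add]; abel
      rw [← hR, hTR, hTR, LinearMap.add_apply, LinearMap.add_apply, Module.End.one_apply,
        Module.End.one_apply, e, form_sub_left, hHs, map_add]
      abel)
  obtain ⟨Y, hYR, hYk⟩ := exists_lieAlgebra_intertwining hF B B' hT hker Y₁
    (fun v hv => by
      rw [← hR, hTR] at hv ⊢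
      rw [hXY, hEk v hv])
    (fun u v => by rw [← hR, hTR, hTR, hXY, hXs, hXY, hEs, add_neg_cancel])
  let X : B.lieAlgebra F hF := momentMap hF B B' h T
  have hXv : ∀ v, (X : Module.End Dᵐᵒᵖ V) v = R (T v) := fun v => rfl
  have hXR : ∀ v, (X : Module.End Dᵐᵒᵖ V) (R v) = R (X' v) := fun v => by rw [hXv, hTR]
  have hXk : ∀ k, T k = 0 → (X : Module.End Dᵐᵒᵖ V) k = 0 := fun k hk => by
    rw [hXv, hk, map_zero]
  rw [← hR] at hHR hYR
  have hext : ∀ Z₁ Z₂ : B.lieAlgebra F hF,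
      (∀ v, (Z₁ : Module.End Dᵐᵒᵖ V) (R v) = (Z₂ : Module.End Dᵐᵒᵖ V) (R v)) →
      (∀ k, T k = 0 → (Z₁ : Module.End Dᵐᵒᵖ V) k = (Z₂ : Module.End Dᵐᵒᵖ V) k) → Z₁ = Z₂ := by
    intro Z₁ Z₂ h₁ h₂
    refine Subtype.ext (LinearMap.ext fun v => ?_)
    obtain ⟨a, k, hk, rfl⟩ := B.exists_eq_adjoint_add B' hT v
    rw [map_add, map_add, h₂ k hk, ← hR, h₁]
  have hbr : ∀ (Z₁ Z₂ : B.lieAlgebra F hF) (v : V), ((⁅Z₁, Z₂⁆ : B.lieAlgebra F hF) :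
      Module.End Dᵐᵒᵖ V) v = (Z₁ : Module.End Dᵐᵒᵖ V) ((Z₂ : Module.End Dᵐᵒᵖ V) v) -
        (Z₂ : Module.End Dᵐᵒᵖ V) ((Z₁ : Module.End Dᵐᵒᵖ V) v) := fun Z₁ Z₂ v => rfl
  let γ : SlTwoTriple (B.lieAlgebra F hF) :=
    { X := X
      H := H
      Y := Y
      lie_H_X := by
        refine hext _ _ (fun v => ?_) fun k hk => ?_
        · rw [hbr, two_smul, AddMemClass.coe_add, LinearMap.add_apply, hHR, hXR, hHR, hXR,
            LinearMap.add_apply, LinearMap.add_apply, Module.End.one_apply, Module.End.one_apply,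
            hHX, map_add X']
          simp only [map_add]
          abel
        · rw [hbr, two_smul, AddMemClass.coe_add, LinearMap.add_apply, hXk k hk, hHk k hk,
            map_zero, map_zero, sub_zero, add_zero]
      lie_H_Y := by
        refine hext _ _ (fun v => ?_) fun k hk => ?_
        · rw [hbr, neg_smul, two_smul, NegMemClass.coe_neg, AddMemClass.coe_add,
            LinearMap.neg_apply, LinearMap.add_apply, hHR, hYR, hHR, hYR, ← map_sub, ← map_add,
            ← map_neg]
          refine hRR _ _ ?_
          have e : H' (E v) = E (H' v) := LinearMap.congr_fun hEH v
          have e2 : X' (H' (Y₁ v)) = H' (E v) - E v - E v := by rw [← hXY v, hHX]; abel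
          rw [map_sub, map_neg, map_add, LinearMap.add_apply, LinearMap.add_apply,
            Module.End.one_apply, Module.End.one_apply, map_add X', map_add Y₁, map_add X',
            hXY, hXY, e2, e]
          abel
        · rw [hbr, neg_smul, two_smul, NegMemClass.coe_neg, AddMemClass.coe_add,
            LinearMap.neg_apply, LinearMap.add_apply, hYk k hk, hHk k hk, map_zero, map_zero,
            sub_zero, add_zero, neg_zero]
      lie_X_Y := by
        refine hext _ _ (fun v => ?_) fun k hk => ?_
        · rw [hbr, hHR, hYR, hXR, hXR, hYR, ← map_sub]
          refine hRR _ _ ?_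
          have e : X' (E v) = E (X' v) + X' ((H' + 1) v) := LinearMap.congr_fun hEX v
          rw [map_sub, hXY, hXY, e, add_sub_cancel_left]
        · rw [hbr, hYk k hk, hXk k hk, hHk k hk, map_zero, map_zero, sub_zero] }
  refine ⟨γ, T, rfl, hTS, fun k v hv => ?_, B.isNondegenerateSubspace_ker B' hT⟩
  have hTH : ∀ v, T ((H : Module.End Dᵐᵒᵖ V) v) = H' (T v) - T v := fun v => by
    obtain ⟨a, k, hk, rfl⟩ := B.exists_eq_adjoint_add B' hT v
    rw [map_add, hHk k hk, add_zero, ← hR, hHR, map_add T, hk, add_zero, hTR, hTR, hHX,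
      LinearMap.add_apply, Module.End.one_apply, map_add]
    abel
  have hv' : (H : Module.End Dᵐᵒᵖ V) v = k • v := hv
  show H' (T v) = (k + 1) • T v
  rw [add_smul, one_smul, ← map_zsmul, ← hv', hTH, sub_add_cancel]

end Existence

end EpsHermitianForm

theorem mainTheorem5 {F : Type*} [Field F] [CharZero F]
    {D : Type*} [DivisionRing D] [StarRing D] [Algebra F D] [Module.Finite F D]
    (hF : ∀ c : F, star (algebraMap F D c) = algebraMap F D c)
    {V : Type*} [AddCommGroup V] [Module F V] [Module Dᵐᵒᵖ V] [IsScalarTower F Dᵐᵒᵖ V]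
    [Module.Finite Dᵐᵒᵖ V]
    {V' : Type*} [AddCommGroup V'] [Module F V'] [Module Dᵐᵒᵖ V'] [IsScalarTower F Dᵐᵒᵖ V']
    [Module.Finite Dᵐᵒᵖ V']
    {ε ε' : ℤˣ} (h : ε * ε' = -1)
    (B : EpsHermitianForm D V ε) (B' : EpsHermitianForm D V' ε')
    (γ' : SlTwoTriple (B'.lieAlgebra F hF))
    (hX' : ∃ S : V →ₗ[Dᵐᵒᵖ] V', EpsHermitianForm.momentMap' hF B B' h S = γ'.X) :
    (∃ γ₀ : SlTwoTriple (B.lieAlgebra F hF), ∀ γ : SlTwoTriple (B.lieAlgebra F hF),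
      (EpsHermitianForm.liftSet B B' h γ γ').Nonempty ↔ B.IsConjTriple γ₀ γ) ∧
    ∀ γ : SlTwoTriple (B.lieAlgebra F hF),
      (EpsHermitianForm.liftSet B B' h γ γ').Nonempty →
        ∃ T : V →ₗ[Dᵐᵒᵖ] V', EpsHermitianForm.liftSet B B' h γ γ' =
          EpsHermitianForm.stabilizerOrbit B B' γ γ' T := by
  refine ⟨?_, ?_⟩
  · obtain ⟨γ₀, T₀, hT₀⟩ := EpsHermitianForm.exists_mem_liftSet h B B' γ' hX'
    refine ⟨γ₀, fun γ => ⟨?_, ?_⟩⟩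
    · rintro ⟨T, hT⟩
      obtain ⟨g, hg, -⟩ := EpsHermitianForm.exists_isometry_of_mem_liftSet hT₀ hT
      exact ⟨g, hg⟩
    · rintro ⟨g, hX, hH, -⟩
      exact ⟨_, EpsHermitianForm.mem_liftSet_of_Ad_eq hT₀ hX hH (Subgroup.one_mem _)⟩
  · rintro γ ⟨T, hT⟩
    refine ⟨T, Set.ext fun T₁ => ⟨fun hT₁ => ?_, ?_⟩⟩
    · obtain ⟨g, hg, hgT⟩ := EpsHermitianForm.exists_isometry_of_mem_liftSet hT hT₁
      refine ⟨g, ⟨hg.2.1, hg.1⟩, 1, Subgroup.one_mem _, LinearMap.ext fun v => ?_⟩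
      have := hgT ((g : V ≃ₗ[Dᵐᵒᵖ] V).symm v)
      rw [LinearEquiv.apply_symm_apply] at this
      exact this
    · rintro ⟨m, hm, m', hm', rfl⟩
      exact EpsHermitianForm.mem_liftSet_of_Ad_eq hT hm.2 hm.1 hm'
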